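/- Let $k$ be a field of characteristic $0$ and let $\mathfrak g$ be a finite-dimensional Loday (left Leibniz) algebra over $k$: a vector space with a bilinear bracket satisfying $[x,[y,z]]=[[x,y],z]+[y,[x,z]]$. Let $\mathfrak g_{Lie}=\mathfrak g/\mathfrak g^{ann}$, where $\mathfrak g^{ann}$ is the span of all $[x,y]+[y,x]$. This is a Lie algebra. Write $\bar x$ for the class of $x\in\mathfrak g$; $\mathfrak g_{Lie}$ acts on $\mathfrak g$ by $\bar x\mapsto [x,\cdot\,]$. *Classical side.* $S(\mathfrak g_{Lie})$ carries the Lie–Poisson bracket, the biderivation with $\{\bar x,\bar y\}=[\bar x,\bar y]$. On $\mathrm{Poly}(\mathfrak g^*)=S(\mathfrak g_{Lie})\otimes\mathfrak g$ one has the perm product and the Loday–Poisson bracket $$(f\otimes x)*(g\otimes y)=f\bar xg\otimes y,\qquad \{f\otimes x,g\otimes y\}=\{f\bar x,g\}\otimes y+g\,\{f\bar x,y\},$$ where $\{\bar x_1\cdots\bar x_n,y\}=\sum_i\bar x_1\cdots\bar x_{i-1}\bar x_{i+1}\cdots\bar x_n\otimes[x_i,y]$. *Quantum side.* Let $U_\hbar(\mathfrak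 g_{Lie})$ be the universal enveloping algebra over $k[[\hbar]]$ of $k[[\hbar]]\otimes\mathfrak g_{Lie}$ with the bracket $\hbar[\cdot,\cdot]$. The enveloping dialgebra $Ud_\hbar(\mathfrak g)=U_\hbar(\mathfrak g_{Lie})\otimes\mathfrak g$ has the $k[[\hbar]]$-bilinear products $$(f\otimes x)\vdash(g\otimes y)=f\bar xg\otimes y,\qquad (f\otimes x)\dashv(1\otimes y)=f\bar y\otimes x-f\otimes\hbar[y,x],$$ $$a\dashv(\bar y_1\cdots\bar y_{n-1}\otimes y_n)=(\cdots(a\dashv(1\otimes y_1))\dashv\cdots)\dashv(1\otimes y_n).$$ A star product here is a $k[[\hbar]]$-bilinear associative product $\star$ with unit $1$ on $S(\mathfrak g_{Lie})[[\hbar]]$ that is a deformation quantization of the Lie–Poisson algebra, i.e. for $f,g\in S(\mathfrak g_{Lie})$ one has $f\star g\equiv fg \pmod \hbar$ and $f\star g-g\star f\equiv\hbar\{f,g\}\pmod{\hbar^2}$, and that satisfies $\bar x\star\bar y-\bar y\star\bar x=\hbar[\bar x,\bar y]$ for $\bar x,\bar y\in\mathfrak g_{Lie}$. Put $S_\star(\mathfrak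 g_{Lie})=(S(\mathfrak g_{Lie})[[\hbar]],\star)$ and $\mathrm{Poly}_\star(\mathfrak g^*)=S_\star(\mathfrak g_{Lie})\otimes\mathfrak g$, and let $I:U_\hbar(\mathfrak g_{Lie})\to S_\star(\mathfrak g_{Lie})$ be the homomorphism of $k[[\hbar]]$-algebras with $I(\bar x)=\bar x$. For $a\in\mathrm{Poly}_\star(\mathfrak g^*)$, let $\lim_{\hbar\to0}a\in\mathrm{Poly}(\mathfrak g^*)$ be its constant term in $\hbar$. **Proposition.** 1. Star products exist; there is even one with $\bar x\star\bar y=\bar x\bar y+\frac{\hbar}{2}[\bar x,\bar y]$ for all $\bar x,\bar y\in\mathfrak g_{Lie}$. 2. For every star product $\star$: (a) $\mathrm{Poly}_\star(\mathfrak g^*)$ is $\hbar$-adically complete, and $I\otimes1:Ud_\hbar(\mathfrak g)\to\mathrm{Poly}_\star(\mathfrak g^*)$ becomes an isomorphism after $\hbar$-adic completion. (b) There is exactly one pair of $k[[\hbar]]$-bilinear products $\vdash_\star,\dashv_\star$ on $\mathrm{Poly}_\star(\mathfrak g^*)$ for which $I\otimes 1$ preserves both products, and it makes $\mathrm{Poly}_\star(\mathfrak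 g^*)$ an associative dialgebra: both products are associative, and $(a\vdash b)\vdash c=(a\dashv b)\vdash c$, $(a\vdash b)\dashv c=a\vdash(b\dashv c)$, $a\dashv(b\dashv c)=a\dashv(b\vdash c)$. (c) For all $a,b\in\mathrm{Poly}_\star(\mathfrak g^*)$, with $a_0=\lim_{\hbar\to0}a$ and $b_0=\lim_{\hbar\to0}b$, the dialgebra commutator $[a,b]_{di}=a\vdash_\star b-b\dashv_\star a$ is uniquely divisible by $\hbar$, and $$\lim_{\hbar\to0}\,(a\vdash_\star b)=a_0*b_0,\qquad \lim_{\hbar\to0}\frac1\hbar[a,b]_{di}=\{a_0,b_0\}.$$ In particular, for $f,g\in S(\mathfrak g_{Lie})$ and $x,y\in\mathfrak g$, $\lim_{\hbar\to0}(f\otimes x)\vdash_\star(g\otimes y)=(f\otimes x)*(g\otimes y)$ and $\lim_{\hbar\to0}\frac1\hbar[f\otimes x,g\otimes y]_{di}=\{f\otimes x,g\otimes y\}$. Hence the polynomial Loday–Poisson algebra $\mathrm{Poly}(\mathfrak g^*)$ is deformation quantizable, with an associative dialgebra as its quantum algebra. -/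

import Mathlib

open scoped TensorProduct PowerSeries

noncomputable section

namespace LodayQuantization

attribute [local instance] LieRing.ofAssociativeRing

/-! ### Loday (Leibniz) algebras and Liezation -/

/-- A (left) Loday algebra, also called a Leibniz algebra: a vector space with a bilinear bracket
satisfying `[x,[y,z]] = [[x,y],z] + [y,[x,z]]`. -/
class LodayAlgebra (k g : Type*) [Field k] [AddCommGroup g] [Module k g] where
  bracket : g →ₗ[k] g →ₗ[k] g
  leibniz : ∀ x y z : g,
    bracket x (bracket y z) = bracket (bracket x y) z + bracket y (bracket x z)

section Liezation

variable (k g : Type*) [Field k] [AddCommGroup g] [Module k g] [LodayAlgebra k g]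

/-- The Loday bracket. -/
abbrev lod : g →ₗ[k] g →ₗ[k] g := LodayAlgebra.bracket

/-- The subspace `g^ann` spanned by the symmetric brackets `[x,y] + [y,x]`. -/
def ann : Submodule k g :=
  Submodule.span k {z | ∃ x y : g, z = lod k g x y + lod k g y x}

variable {k g} in
theorem lod_ann_left {a : g} (ha : a ∈ ann k g) (z : g) : lod k g a z = 0 := by
  induction ha using Submodule.span_induction with
  | mem a h =>
    obtain ⟨x, y, rfl⟩ := h
    have h3 : lod k g (lod k g x y) z + lod k g (lod k g y x) z + lod k g x (lod k g y z)
        = lod k g x (lod k g y z) := by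
      conv_rhs => rw [LodayAlgebra.leibniz (k := k) x y z, LodayAlgebra.leibniz (k := k) y x z]
      abel
    simpa using h3
  | zero => simp
  | add a b _ _ h1 h2 => simp [h1, h2]
  | smul c a _ h => simp [h]

variable {k g} in
theorem lod_ann_right {a : g} (ha : a ∈ ann k g) (x : g) : lod k g x a ∈ ann k g := by
  induction ha using Submodule.span_induction with
  | mem a h =>
    obtain ⟨y, z, rfl⟩ := h
    have e : lod k g x (lod k g y z + lod k g z y) =
        (lod k g (lod k g x y) z + lod k g z (lod k g x y)) +
          (lod k g y (lod k g x z) + lod k g (lod k g x z) y) := by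
      rw [map_add, LodayAlgebra.leibniz (k := k) x y z, LodayAlgebra.leibniz (k := k) x z y]
      abel
    rw [e]
    exact add_mem (Submodule.subset_span ⟨_, _, rfl⟩) (Submodule.subset_span ⟨_, _, rfl⟩)
  | zero => simp
  | add a b _ _ h1 h2 => rw [map_add]; exact add_mem h1 h2
  | smul c a _ h => rw [map_smul]; exact Submodule.smul_mem _ _ h

/-- The Liezation `g_Lie = g / g^ann`. -/
abbrev GLie : Type _ := g ⧸ ann k g

/-- The projection `x ↦ x̄` of `g` onto `g_Lie`. -/
abbrev proj : g →ₗ[k] GLie k g := (ann k g).mkQ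

/-- The action of `g_Lie` on `g`: `x̄` sends `y` to `[x,y]`. -/
def ad : GLie k g →ₗ[k] g →ₗ[k] g :=
  (ann k g).liftQ (lod k g) fun _ ha => LinearMap.ext fun z => lod_ann_left ha z

@[simp] theorem ad_proj (x y : g) : ad k g (Submodule.Quotient.mk x) y = lod k g x y := rfl

variable {k g} in
theorem ann_le_comap_ad (x : GLie k g) : ann k g ≤ (ann k g).comap (ad k g x) := by
  obtain ⟨x, rfl⟩ := Submodule.Quotient.mk_surjective _ x
  exact fun _ ha => lod_ann_right ha x

/-- The bracket of `g_Lie`: the class of `[x,y]` for the classes of `x` and `y`. -/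
instance : Bracket (GLie k g) (GLie k g) where
  bracket x y := (ann k g).mapQ (ann k g) (ad k g x) (ann_le_comap_ad x) y

theorem lie_mk (x y : g) :
    ⁅(Submodule.Quotient.mk x : GLie k g), (Submodule.Quotient.mk y : GLie k g)⁆ =
      Submodule.Quotient.mk (lod k g x y) := rfl

instance [CharZero k] : LieRing (GLie k g) where
  add_lie x y z := by
    obtain ⟨x, rfl⟩ := Submodule.Quotient.mk_surjective _ x
    obtain ⟨y, rfl⟩ := Submodule.Quotient.mk_surjective _ y
    obtain ⟨z, rfl⟩ := Submodule.Quotient.mk_surjective _ z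
    simp only [← Submodule.Quotient.mk_add, lie_mk, map_add, LinearMap.add_apply]
  lie_add x y z := by
    obtain ⟨x, rfl⟩ := Submodule.Quotient.mk_surjective _ x
    obtain ⟨y, rfl⟩ := Submodule.Quotient.mk_surjective _ y
    obtain ⟨z, rfl⟩ := Submodule.Quotient.mk_surjective _ z
    simp only [← Submodule.Quotient.mk_add, lie_mk, map_add]
  lie_self x := by
    obtain ⟨x, rfl⟩ := Submodule.Quotient.mk_surjective _ x
    rw [lie_mk, Submodule.Quotient.mk_eq_zero]
    have h : (2 : k)⁻¹ • (lod k g x x + lod k g x x) ∈ ann k g :=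
      Submodule.smul_mem _ _ (Submodule.subset_span ⟨x, x, rfl⟩)
    rwa [← two_smul k, smul_smul, inv_mul_cancel₀ two_ne_zero, one_smul] at h
  leibniz_lie x y z := by
    obtain ⟨x, rfl⟩ := Submodule.Quotient.mk_surjective _ x
    obtain ⟨y, rfl⟩ := Submodule.Quotient.mk_surjective _ y
    obtain ⟨z, rfl⟩ := Submodule.Quotient.mk_surjective _ z
    simp only [lie_mk, ← Submodule.Quotient.mk_add]
    rw [LodayAlgebra.leibniz (k := k) x y z]

instance [CharZero k] : LieAlgebra k (GLie k g) where
  lie_smul c x y := by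
    obtain ⟨x, rfl⟩ := Submodule.Quotient.mk_surjective _ x
    obtain ⟨y, rfl⟩ := Submodule.Quotient.mk_surjective _ y
    simp only [← Submodule.Quotient.mk_smul, lie_mk, map_smul]

theorem ad_lie [CharZero k] (x y : GLie k g) (z : g) :
    ad k g ⁅x, y⁆ z = ad k g x (ad k g y z) - ad k g y (ad k g x z) := by
  obtain ⟨x, rfl⟩ := Submodule.Quotient.mk_surjective _ x
  obtain ⟨y, rfl⟩ := Submodule.Quotient.mk_surjective _ y
  simp only [lie_mk, ad_proj]
  rw [LodayAlgebra.leibniz (k := k) x y z]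
  abel

end Liezation

/-! ### The Lie-Poisson algebra `S(L)` of a Lie algebra -/

section LiePoisson

variable (k L : Type*) [Field k] [AddCommGroup L] [Module k L]

/-- The symmetric algebra `S(L)`. -/
abbrev Sym : Type _ := SymmetricAlgebra k L

/-- The generator of `S(L)` given by an element of `L`. -/
abbrev gen : L →ₗ[k] Sym k L := SymmetricAlgebra.ι k L

/-- The algebra map `f ↦ f + df` from `S(L)` to the square-zero extension of `S(L)` by
`S(L) ⊗ L`, sending a generator `x` to `x + 1 ⊗ x`. -/
def jet : Sym k L →ₐ[k] TrivSqZeroExt (Sym k L) (Sym k L ⊗[k] L) :=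
  SymmetricAlgebra.lift
    ((TrivSqZeroExt.inlAlgHom k (Sym k L) (Sym k L ⊗[k] L)).toLinearMap ∘ₗ gen k L +
      (TrivSqZeroExt.inrHom (Sym k L) (Sym k L ⊗[k] L)).restrictScalars k ∘ₗ
        TensorProduct.mk k (Sym k L) L 1)

theorem jet_gen (x : L) :
    jet k L (gen k L x) = TrivSqZeroExt.inl (gen k L x) + TrivSqZeroExt.inr (1 ⊗ₜ[k] x) := by
  simp [jet]

theorem fst_jet (f : Sym k L) : (jet k L f).fst = f := by
  have : (TrivSqZeroExt.fstHom k (Sym k L) (Sym k L ⊗[k] L)).comp (jet k L)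
      = AlgHom.id k (Sym k L) := by
    apply SymmetricAlgebra.algHom_ext
    ext x
    simp [jet_gen]
  exact congrArg (fun F => F f) this

/-- The total differential `d : S(L) → S(L) ⊗ L`, `f ↦ ∑ ∂f/∂eᵢ ⊗ eᵢ`, that is, the derivation
with `d x = 1 ⊗ x` on generators. -/
def diff : Derivation k (Sym k L) (Sym k L ⊗[k] L) :=
  Derivation.mk'
    ((TrivSqZeroExt.sndHom (Sym k L) (Sym k L ⊗[k] L)).restrictScalars k ∘ₗ
      (jet k L).toLinearMap)
    fun f h => by simp [fst_jet]

theorem diff_gen (x : L) : diff k L (gen k L x) = 1 ⊗ₜ[k] x := by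
  change (jet k L (gen k L x)).snd = _
  simp [jet_gen]

variable {k L} in
/-- The unique derivation `S(L) → N` that extends a linear map `B : L → N`. -/
def extendDer {N : Type*} [AddCommGroup N] [Module k N] [Module (Sym k L) N]
    [IsScalarTower k (Sym k L) N] (B : L →ₗ[k] N) : Derivation k (Sym k L) N :=
  (B.liftBaseChange (Sym k L)).compDer (diff k L)

theorem extendDer_gen {N : Type*} [AddCommGroup N] [Module k N] [Module (Sym k L) N]
    [IsScalarTower k (Sym k L) N] (B : L →ₗ[k] N) (x : L) :
    extendDer B (gen k L x) = B x := by
  simp [extendDer, diff_gen]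

theorem der_ext {N : Type*} [AddCommGroup N] [Module k N] [Module (Sym k L) N]
    {D E : Derivation k (Sym k L) N} (h : ∀ x, D (gen k L x) = E (gen k L x)) : D = E := by
  ext f
  induction f using SymmetricAlgebra.induction with
  | algebraMap r => simp
  | ι x => exact h x
  | mul a b ha hb => rw [D.leibniz, E.leibniz, ha, hb]
  | add a b ha hb => rw [map_add, map_add, ha, hb]

end LiePoisson

section Poisson

variable (k L : Type*) [Field k] [LieRing L] [LieAlgebra k L]

/-- The map `x ↦ {x, ·}`, where for `x` in `L` the operator `{x, ·}` is the derivation of `S(L)`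
that extends `[x, ·]`. -/
def hamiltonian : L →ₗ[k] Sym k L →ₗ[k] Sym k L where
  toFun x := (extendDer (gen k L ∘ₗ (LieAlgebra.ad k L x : L →ₗ[k] L)) :
    Derivation k (Sym k L) (Sym k L))
  map_add' x y := by
    rw [← Derivation.coe_add_linearMap]
    congr 1
    apply der_ext
    intro z
    simp [extendDer_gen]
  map_smul' c x := by
    rw [RingHom.id_apply, ← Derivation.coe_smul_linearMap]
    congr 1
    apply der_ext
    intro z
    simp [extendDer_gen]

/-- The Lie-Poisson bracket `f ↦ {f, ·}` of `S(L)`: the biderivation with `{x, y} = [x, y]` for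
`x, y` in `L`. -/
def poisson : Derivation k (Sym k L) (Sym k L →ₗ[k] Sym k L) :=
  extendDer (hamiltonian k L)

theorem poisson_gen (x y : L) : poisson k L (gen k L x) (gen k L y) = gen k L ⁅x, y⁆ := by
  simp [poisson, hamiltonian, extendDer_gen]

theorem poisson_mul_left (f f' h : Sym k L) :
    poisson k L (f * f') h = f * poisson k L f' h + f' * poisson k L f h := by
  simp [Derivation.leibniz]

theorem poisson_mul_right (f h h' : Sym k L) :
    poisson k L f (h * h') = h * poisson k L f h' + h' * poisson k L f h := by
  induction f using SymmetricAlgebra.induction with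
  | algebraMap r => simp
  | ι x => simp [poisson, hamiltonian, extendDer_gen, Derivation.leibniz]
  | mul a b ha hb => rw [poisson_mul_left, poisson_mul_left, poisson_mul_left, ha, hb]; ring
  | add a b ha hb => simp only [map_add, LinearMap.add_apply, ha, hb]; ring

end Poisson

/-! ### The polynomial Loday-Poisson algebra `Poly(g^*) = S(g_Lie) ⊗ g` -/

section Poly

variable (k g : Type*) [Field k] [AddCommGroup g] [Module k g] [LodayAlgebra k g]

/-- `Poly(g^*) = S(g_Lie) ⊗ g`. -/
abbrev Poly : Type _ := Sym k (GLie k g) ⊗[k] g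

/-- The projection `f ⊗ x ↦ f x̄` of `Poly(g^*)` into `S(g_Lie)`. -/
def polyBar : Poly k g →ₗ[Sym k (GLie k g)] Sym k (GLie k g) :=
  (gen k (GLie k g) ∘ₗ proj k g).liftBaseChange (Sym k (GLie k g))

/-- The perm product `(f ⊗ x) * (h ⊗ y) = f x̄ h ⊗ y`. -/
def perm (a b : Poly k g) : Poly k g := polyBar k g a • b

/-- The bracket `{f, y}` of `f` in `S(g_Lie)` with `y` in `g`, where
`{x̄₁ ⋯ x̄ₙ, y} = ∑ᵢ x̄₁ ⋯ x̄ᵢ₋₁ x̄ᵢ₊₁ ⋯ x̄ₙ ⊗ [xᵢ, y]`. -/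
def actLin : g →ₗ[k] Sym k (GLie k g) →ₗ[k] Poly k g where
  toFun y := (extendDer (TensorProduct.mk k (Sym k (GLie k g)) g 1 ∘ₗ (ad k g).flip y) :
    Derivation k (Sym k (GLie k g)) (Poly k g))
  map_add' x y := by
    rw [← Derivation.coe_add_linearMap]
    congr 1
    apply der_ext
    intro z
    simp [extendDer_gen, TensorProduct.tmul_add]
  map_smul' c x := by
    rw [RingHom.id_apply, ← Derivation.coe_smul_linearMap]
    congr 1
    apply der_ext
    intro z
    simp [extendDer_gen]

theorem perm_tmul (f h : Sym k (GLie k g)) (x y : g) :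
    perm k g (f ⊗ₜ x) (h ⊗ₜ y) = (f * gen k (GLie k g) (proj k g x) * h) ⊗ₜ y := by
  simp [perm, polyBar, TensorProduct.smul_tmul']

theorem actLin_gen (x y : g) :
    actLin k g y (gen k (GLie k g) (proj k g x)) = 1 ⊗ₜ lod k g x y := by
  simp [actLin, extendDer_gen]

theorem actLin_mul (f h : Sym k (GLie k g)) (y : g) :
    actLin k g y (f * h) = f • actLin k g y h + h • actLin k g y f := by
  simp [actLin, Derivation.leibniz]

variable [CharZero k]

/-- The action `{f, h ⊗ y} = {f, h} ⊗ y + h {f, y}` of `S(g_Lie)` on `Poly(g^*)`. -/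
def act (f : Sym k (GLie k g)) : Poly k g →ₗ[k] Poly k g :=
  (poisson k (GLie k g) f).rTensor g +
    (((actLin k g).flip f).liftBaseChange (Sym k (GLie k g))).restrictScalars k

/-- The Loday-Poisson bracket `{f ⊗ x, h ⊗ y} = {f x̄, h ⊗ y}`. -/
def lodayPoisson (a b : Poly k g) : Poly k g := act k g (polyBar k g a) b

theorem lodayPoisson_tmul (f h : Sym k (GLie k g)) (x y : g) :
    lodayPoisson k g (f ⊗ₜ x) (h ⊗ₜ y) =
      poisson k (GLie k g) (f * gen k (GLie k g) (proj k g x)) h ⊗ₜ y +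
        h • actLin k g y (f * gen k (GLie k g) (proj k g x)) := by
  simp only [lodayPoisson, act, polyBar, LinearMap.liftBaseChange_tmul, LinearMap.add_apply,
    LinearMap.rTensor_tmul, LinearMap.restrictScalars_apply, LinearMap.flip_apply,
    LinearMap.comp_apply, smul_eq_mul]

end Poly

/-! ### Associative dialgebras -/

/-- The axioms of an associative dialgebra for a pair of products `vd` (`⊢`) and `dv` (`⊣`). -/
structure IsAssociativeDialgebra {D : Type*} (vd dv : D → D → D) : Prop where
  vd_assoc : ∀ a b c, vd (vd a b) c = vd a (vd b c)
  dv_assoc : ∀ a b c, dv (dv a b) c = dv a (dv b c)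
  vd_vd : ∀ a b c, vd (vd a b) c = vd (dv a b) c
  vd_dv : ∀ a b c, dv (vd a b) c = vd a (dv b c)
  dv_dv : ∀ a b c, dv a (dv b c) = dv a (vd b c)

/-! ### The enveloping algebra `U_ħ` and the enveloping dialgebra `Ud_ħ` -/

section Enveloping

variable (k L : Type*) [Field k] [LieRing L] [LieAlgebra k L]

/-- The deformation parameter `ħ` of `k[[ħ]]`. -/
abbrev hbar : k⟦X⟧ := PowerSeries.X

/-- A Lie algebra `M` over `R`, to be equipped with the rescaled bracket `c[·,·]`. -/
def Rescaled {R : Type*} (M : Type*) (_c : R) : Type _ := M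

section Rescaled

variable {R M : Type*} [CommRing R] [LieRing M] [LieAlgebra R M] (c : R)

instance : AddCommGroup (Rescaled M c) := inferInstanceAs (AddCommGroup M)
instance : Module R (Rescaled M c) := inferInstanceAs (Module R M)

variable (R M) in
/-- The identity map from `M` with its own bracket to `M` with the bracket `c[·,·]`. -/
def rescale : M ≃ₗ[R] Rescaled M c := LinearEquiv.refl R M

instance : Bracket (Rescaled M c) (Rescaled M c) where
  bracket x y := rescale R M c (c • ⁅(rescale R M c).symm x, (rescale R M c).symm y⁆)

theorem rescaled_lie (x y : Rescaled M c) :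
    ⁅x, y⁆ = rescale R M c (c • ⁅(rescale R M c).symm x, (rescale R M c).symm y⁆) := rfl

instance : LieRing (Rescaled M c) where
  add_lie x y z := by simp only [rescaled_lie, map_add, add_lie, smul_add]
  lie_add x y z := by simp only [rescaled_lie, map_add, lie_add, smul_add]
  lie_self x := by simp only [rescaled_lie, lie_self, smul_zero, map_zero]
  leibniz_lie x y z := by
    simp only [rescaled_lie, LinearEquiv.symm_apply_apply, lie_smul, smul_lie, ← map_add,
      ← smul_add, ← leibniz_lie]

instance : LieAlgebra R (Rescaled M c) where
  lie_smul r x y := by simp only [rescaled_lie, map_smul, lie_smul, smul_comm c r]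

end Rescaled

/-- `k[[ħ]] ⊗ L` with the Lie bracket `ħ[·,·]`. -/
abbrev HLie : Type _ := Rescaled (k⟦X⟧ ⊗[k] L) (hbar k)

/-- `U_ħ(L)`: the universal enveloping algebra over `k[[ħ]]` of `L` with the bracket `ħ[·,·]`. -/
abbrev Uh : Type _ := UniversalEnvelopingAlgebra (k⟦X⟧) (HLie k L)

instance : Algebra k (Uh k L) := Algebra.compHom (Uh k L) (algebraMap k (k⟦X⟧))
instance : IsScalarTower k (k⟦X⟧) (Uh k L) := .of_algebraMap_eq' rfl

/-- The canonical map `L → U_ħ(L)`. -/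
def ugen : L →ₗ[k] Uh k L :=
  ((UniversalEnvelopingAlgebra.ι (k⟦X⟧) : HLie k L →ₗ⁅k⟦X⟧⁆ Uh k L).toLinearMap ∘ₗ
    (rescale (k⟦X⟧) (k⟦X⟧ ⊗[k] L) (hbar k)).toLinearMap).restrictScalars k ∘ₗ
    TensorProduct.mk k (k⟦X⟧) L 1

variable {k L} in
/-- Universal property of `U_ħ(L)`: a `k`-linear map `φ` from `L` to a `k[[ħ]]`-algebra with
`φ x φ y - φ y φ x = ħ φ [x,y]` extends to an algebra homomorphism. -/
def ulift {A : Type*} [Ring A] [Algebra (k⟦X⟧) A] [Module k A] [IsScalarTower k (k⟦X⟧) A]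
    (φ : L →ₗ[k] A) (hφ : ∀ x y, φ x * φ y - φ y * φ x = hbar k • φ ⁅x, y⁆) :
    Uh k L →ₐ[k⟦X⟧] A :=
  UniversalEnvelopingAlgebra.lift (k⟦X⟧)
    { φ.liftBaseChange (k⟦X⟧) ∘ₗ
        (rescale (k⟦X⟧) (k⟦X⟧ ⊗[k] L) (hbar k)).symm.toLinearMap with
      map_lie' := fun {x y} => by
        obtain ⟨x, rfl⟩ := (rescale (k⟦X⟧) (k⟦X⟧ ⊗[k] L) (hbar k)).surjective x
        obtain ⟨y, rfl⟩ := (rescale (k⟦X⟧) (k⟦X⟧ ⊗[k] L) (hbar k)).surjective y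
        simp only [AddHom.toFun_eq_coe, LinearMap.coe_toAddHom, LinearMap.comp_apply,
          LinearEquiv.coe_coe, rescaled_lie, LinearEquiv.symm_apply_apply]
        induction x with
        | zero => simp
        | add a b ha hb => simp only [add_lie, map_add, smul_add, ha, hb]
        | tmul p x =>
          induction y with
          | zero => simp
          | add a b ha hb => simp only [lie_add, map_add, smul_add, ha, hb]
          | tmul q y =>
            rw [LieAlgebra.ExtendScalars.bracket_tmul]
            simp only [map_smul, LinearMap.liftBaseChange_tmul,
              LieRing.of_associative_ring_bracket, smul_mul_smul_comm]
            rw [mul_comm q p, ← smul_sub, hφ, smul_comm] }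

theorem ulift_ugen {A : Type*} [Ring A] [Algebra (k⟦X⟧) A] [Module k A]
    [IsScalarTower k (k⟦X⟧) A] (φ : L →ₗ[k] A)
    (hφ : ∀ x y, φ x * φ y - φ y * φ x = hbar k • φ ⁅x, y⁆) (x : L) :
    ulift φ hφ (ugen k L x) = φ x := by
  have h : ugen k L x =
      UniversalEnvelopingAlgebra.ι (k⟦X⟧) (rescale (k⟦X⟧) (k⟦X⟧ ⊗[k] L) (hbar k) (1 ⊗ₜ x)) := rfl
  rw [h, ulift, UniversalEnvelopingAlgebra.lift_ι_apply]
  change φ.liftBaseChange (k⟦X⟧) (1 ⊗ₜ x) = φ x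
  simp

theorem ugen_comm (x y : L) :
    ugen k L x * ugen k L y - ugen k L y * ugen k L x = hbar k • ugen k L ⁅x, y⁆ := by
  have h := (UniversalEnvelopingAlgebra.ι (k⟦X⟧) (L := HLie k L)).map_lie
    (rescale _ _ _ (1 ⊗ₜ x)) (rescale _ _ _ (1 ⊗ₜ y))
  rw [rescaled_lie, LinearEquiv.symm_apply_apply, LinearEquiv.symm_apply_apply,
    LieAlgebra.ExtendScalars.bracket_tmul, mul_one, map_smul, map_smul] at h
  exact h.symm

end Enveloping

section EnvelopingDialgebra

variable (k g : Type*) [Field k] [CharZero k] [AddCommGroup g] [Module k g] [LodayAlgebra k g]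

/-- `Ud_ħ(g) = U_ħ(g_Lie) ⊗ g`, the universal enveloping dialgebra of `g` with bracket `ħ[·,·]`. -/
abbrev Ud : Type _ := Uh k (GLie k g) ⊗[k] g

/-- The projection `f ⊗ x ↦ f x̄` of `Ud_ħ(g)` into `U_ħ(g_Lie)`. -/
def udBar : Ud k g →ₗ[k] Uh k (GLie k g) :=
  TensorProduct.lift ((LinearMap.mul k (Uh k (GLie k g))).compl₂ (ugen k (GLie k g) ∘ₗ proj k g))

/-- The product `⊢` of `Ud_ħ(g)`: `f ⊗ x ⊢ h ⊗ y = f x̄ h ⊗ y`. -/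
def udVd (a b : Ud k g) : Ud k g := udBar k g a • b

/-- The operator `f ⊗ x ↦ f ȳ ⊗ x - f ⊗ ħ[y,x]` on `Ud_ħ(g)`, linear in `ȳ`. -/
def rightOp : GLie k g →ₗ[k] Module.End (k⟦X⟧) (Ud k g) where
  toFun y :=
    TensorProduct.AlgebraTensorModule.map (LinearMap.mulRight (k⟦X⟧) (ugen k (GLie k g) y))
      (LinearMap.id : g →ₗ[k] g) -
    hbar k • TensorProduct.AlgebraTensorModule.map
      (LinearMap.id : Uh k (GLie k g) →ₗ[k⟦X⟧] Uh k (GLie k g)) (ad k g y)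
  map_add' y z := by
    apply TensorProduct.AlgebraTensorModule.ext
    intro f x
    simp [mul_add, TensorProduct.add_tmul, TensorProduct.tmul_add]
    abel
  map_smul' c y := by
    apply TensorProduct.AlgebraTensorModule.ext
    intro f x
    simp only [map_smul, RingHom.id_apply, LinearMap.smul_apply, LinearMap.sub_apply,
      TensorProduct.AlgebraTensorModule.map_tmul, LinearMap.mulRight_apply, LinearMap.id_apply,
      TensorProduct.tmul_smul, mul_smul_comm, ← TensorProduct.smul_tmul', smul_sub]
    rw [smul_comm c (hbar k)]

theorem rightOp_tmul (y : GLie k g) (f : Uh k (GLie k g)) (x : g) :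
    rightOp k g y (f ⊗ₜ x) =
      (f * ugen k (GLie k g) y) ⊗ₜ x - hbar k • (f ⊗ₜ[k] ad k g y x) := by
  simp [rightOp]

/-- The right action of `U_ħ(g_Lie)` on `Ud_ħ(g)` in which `ȳ` acts by
`(f ⊗ x) · ȳ = f ȳ ⊗ x - f ⊗ ħ[y,x]`. -/
def rightAct : Uh k (GLie k g) →ₐ[k⟦X⟧] (Module.End (k⟦X⟧) (Ud k g))ᵐᵒᵖ :=
  ulift (((MulOpposite.opLinearEquiv k).toLinearMap ∘ₗ rightOp k g)) fun y z => by
    apply MulOpposite.unop_injective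
    apply TensorProduct.AlgebraTensorModule.ext
    intro f x
    simp only [LinearMap.comp_apply, LinearEquiv.coe_coe, MulOpposite.coe_opLinearEquiv,
      MulOpposite.unop_sub, MulOpposite.unop_mul, MulOpposite.unop_op, MulOpposite.unop_smul,
      LinearMap.sub_apply, LinearMap.smul_apply, Module.End.mul_apply, rightOp_tmul, map_sub,
      map_smul, ad_lie, TensorProduct.tmul_sub, smul_sub]
    have h := congrArg (fun u => (f * u) ⊗ₜ[k] x) (ugen_comm k (GLie k g) y z)
    simp only [mul_sub, mul_smul_comm, TensorProduct.sub_tmul, ← TensorProduct.smul_tmul',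
      ← mul_assoc] at h
    rw [← h]
    abel

/-- The product `⊣` of `Ud_ħ(g)`: `f ⊗ x ⊣ 1 ⊗ y = f ȳ ⊗ x - f ⊗ ħ[y,x]`, and
`a ⊣ (ȳ₁ ⋯ ȳₙ₋₁ ⊗ yₙ) = (⋯ (a ⊣ 1 ⊗ y₁) ⊣ ⋯) ⊣ 1 ⊗ yₙ`. -/
def udDv (a b : Ud k g) : Ud k g := (rightAct k g (udBar k g b)).unop a

theorem udVd_tmul (f h : Uh k (GLie k g)) (x y : g) :
    udVd k g (f ⊗ₜ x) (h ⊗ₜ y) = (f * ugen k (GLie k g) (proj k g x) * h) ⊗ₜ y := by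
  simp [udVd, udBar, TensorProduct.smul_tmul']

theorem udDv_one_tmul (f : Uh k (GLie k g)) (x y : g) :
    udDv k g (f ⊗ₜ x) (1 ⊗ₜ y) =
      (f * ugen k (GLie k g) (proj k g y)) ⊗ₜ x - hbar k • (f ⊗ₜ[k] lod k g y x) := by
  simp [udDv, udBar, rightAct, ulift_ugen, rightOp_tmul]

theorem udDv_mul_tmul (a : Ud k g) (h : Uh k (GLie k g)) (y z : g) :
    udDv k g a ((ugen k (GLie k g) (proj k g y) * h) ⊗ₜ z) =
      udDv k g (udDv k g a (1 ⊗ₜ y)) (h ⊗ₜ z) := by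
  simp [udDv, udBar]

end EnvelopingDialgebra

/-! ### Star products on `S(L)[[ħ]]` -/

section Star

variable (k L : Type*) [Field k] [LieRing L] [LieAlgebra k L]

/-- The space `S(L)[[ħ]]`. -/
abbrev SymH : Type _ := (Sym k L)⟦X⟧

instance : IsScalarTower k (k⟦X⟧) (SymH k L) := ⟨fun c p f => by
  have h : PowerSeries.map (algebraMap k (Sym k L)) (c • p) =
      c • PowerSeries.map (algebraMap k (Sym k L)) p := by
    ext n
    rw [PowerSeries.coeff_map, PowerSeries.coeff_smul, PowerSeries.coeff_smul,
      PowerSeries.coeff_map, smul_eq_mul, map_mul, Algebra.smul_def]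
  rw [Algebra.smul_def, Algebra.smul_def p, PowerSeries.algebraMap_apply'',
    PowerSeries.algebraMap_apply'', h, smul_mul_assoc]⟩

/-- The constant series in `S(L)[[ħ]]` given by an element of `S(L)`. -/
def const : Sym k L →ₗ[k] SymH k L where
  toFun := PowerSeries.C
  map_add' := map_add _
  map_smul' c f := by
    ext n
    simp [PowerSeries.coeff_C]

/-- A star product on `S(L)[[ħ]]`, that is, a (formal) deformation quantization of the Lie-Poisson
algebra `S(L)`, with the normalisation `x ⋆ y - y ⋆ x = ħ [x,y]` on the generators `x, y ∈ L`:
a `k[[ħ]]`-bilinear unital associative product on `S(L)[[ħ]]` such that, for `f, h ∈ S(L)`,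
`f ⋆ h` has the constant term `f h` and `f ⋆ h - h ⋆ f` has the coefficient `{f,h}` at `ħ`. -/
structure StarProduct where
  mul : SymH k L →ₗ[k⟦X⟧] SymH k L →ₗ[k⟦X⟧] SymH k L
  one_mul : ∀ a, mul 1 a = a
  mul_one : ∀ a, mul a 1 = a
  assoc : ∀ a b c, mul (mul a b) c = mul a (mul b c)
  classical_limit : ∀ f h : Sym k L,
    PowerSeries.coeff 0 (mul (const k L f) (const k L h)) = f * h
  semiclassical_limit : ∀ f h : Sym k L,
    PowerSeries.coeff 1 (mul (const k L f) (const k L h) - mul (const k L h) (const k L f)) =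
      poisson k L f h
  gen_comm : ∀ x y : L,
    mul (const k L (gen k L x)) (const k L (gen k L y)) -
      mul (const k L (gen k L y)) (const k L (gen k L x)) =
        hbar k • const k L (gen k L ⁅x, y⁆)

variable {k L}

/-- The algebra `S_⋆(L) = (S(L)[[ħ]], ⋆)`. -/
def StarAlg (_P : StarProduct k L) : Type _ := SymH k L

namespace StarAlg

variable (P : StarProduct k L)

instance : AddCommGroup (StarAlg P) := inferInstanceAs (AddCommGroup (SymH k L))
instance : Module k (StarAlg P) := inferInstanceAs (Module k (SymH k L))
instance : Module (k⟦X⟧) (StarAlg P) := inferInstanceAs (Module (k⟦X⟧) (SymH k L))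
instance : IsScalarTower k (k⟦X⟧) (StarAlg P) :=
  inferInstanceAs (IsScalarTower k (k⟦X⟧) (SymH k L))

/-- The identity map from `S(L)[[ħ]]` to `S_⋆(L)`. -/
def of : SymH k L ≃ₗ[k⟦X⟧] StarAlg P := LinearEquiv.refl _ _

instance : Mul (StarAlg P) := ⟨fun a b => of P (P.mul ((of P).symm a) ((of P).symm b))⟩
instance : One (StarAlg P) := ⟨of P 1⟩

theorem mul_def (a b : StarAlg P) : a * b = of P (P.mul ((of P).symm a) ((of P).symm b)) := rfl
theorem one_def : (1 : StarAlg P) = of P 1 := rfl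

instance : Ring (StarAlg P) where
  left_distrib a b c := by simp [mul_def]
  right_distrib a b c := by simp [mul_def]
  zero_mul a := by simp [mul_def]
  mul_zero a := by simp [mul_def]
  mul_assoc a b c := by simp [mul_def, P.assoc]
  one_mul a := by simp [mul_def, one_def, P.one_mul]
  mul_one a := by simp [mul_def, one_def, P.mul_one]
  sub_eq_add_neg := sub_eq_add_neg
  neg_add_cancel := neg_add_cancel
  zsmul := zsmulRec

instance : Algebra (k⟦X⟧) (StarAlg P) :=
  Algebra.ofModule (fun r a b => by simp [mul_def]) (fun r a b => by simp [mul_def])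

end StarAlg

/-- The algebra homomorphism `I : U_ħ(L) → S_⋆(L)` with `I(x) = x` for `x ∈ L`. -/
def starHom (P : StarProduct k L) : Uh k L →ₐ[k⟦X⟧] StarAlg P :=
  ulift (((StarAlg.of P).toLinearMap.restrictScalars k) ∘ₗ const k L ∘ₗ gen k L) fun x y => by
    simpa [StarAlg.mul_def] using congrArg (StarAlg.of P) (P.gen_comm x y)

end Star

/-! ### The space `Poly_⋆(g^*)` and the map `I ⊗ 1` -/

section PolyStar

variable (k g : Type*) [Field k] [CharZero k] [AddCommGroup g] [Module k g] [LodayAlgebra k g]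

/-- The space `Poly_⋆(g^*) = S(g_Lie)[[ħ]] ⊗ g`. -/
abbrev PolyStar : Type _ := SymH k (GLie k g) ⊗[k] g

variable {k g} in
/-- The map `I ⊗ 1 : Ud_ħ(g) → Poly_⋆(g^*)`. -/
def starMap (P : StarProduct k (GLie k g)) : Ud k g →ₗ[k⟦X⟧] PolyStar k g :=
  TensorProduct.AlgebraTensorModule.map
    ((StarAlg.of P).symm.toLinearMap ∘ₗ (starHom P).toLinearMap) (LinearMap.id : g →ₗ[k] g)

/-- The limit `ħ → 0`: the map `Poly_⋆(g^*) → Poly(g^*)` that takes the constant term in `ħ`. -/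
def limZero : PolyStar k g →ₗ[k] Poly k g :=
  LinearMap.rTensor g
    { toFun := PowerSeries.coeff 0
      map_add' := map_add _
      map_smul' := fun c f => by simp }

variable {k g} in
/-- The `k[[ħ]]`-bilinear products `vd` and `dv` on `Poly_⋆(g^*)` are the transport along `I ⊗ 1`
of the products `⊢` and `⊣` of `Ud_ħ(g)`. -/
def IsTransport (P : StarProduct k (GLie k g))
    (vd dv : PolyStar k g →ₗ[k⟦X⟧] PolyStar k g →ₗ[k⟦X⟧] PolyStar k g) : Prop :=
  (∀ a b : Ud k g, starMap P (udVd k g a b) = vd (starMap P a) (starMap P b)) ∧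
  (∀ a b : Ud k g, starMap P (udDv k g a b) = dv (starMap P a) (starMap P b))

end PolyStar

end LodayQuantization

end

open scoped TensorProduct PowerSeries

noncomputable section

namespace LodayQuantization

attribute [local instance] LieRing.ofAssociativeRing

/-! ### Linear maps that are isomorphisms modulo every power of a parameter -/

section Adic

variable {R : Type*} [CommRing R] {h : R}
variable {U V M N : Type*} [AddCommGroup U] [Module R U] [AddCommGroup V] [Module R V]
  [AddCommGroup M] [Module R M] [AddCommGroup N] [Module R N]

/-! Everything rests on one notion: a map `j : U → V` that is an isomorphism modulo `ħ`, with `V`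
free of `ħ`-torsion (`IsEquivMod`). Such a `j` is an isomorphism modulo every `ħ ^ n`, hence after
completion, and multilinear maps into complete modules extend uniquely along it, whether or not `U`
itself is complete or torsion free.

For `j = I` the property needs no Poincaré–Birkhoff–Witt theorem. The constant term of `I` is
multiplicative and hits the generators, so `I` is onto modulo `ħ`. Since `U_ħ / ħ U_ħ` is
commutative, it receives an algebra map from `S(L)`, and composing this map with the constant term
of `I` gives back the projection of `U_ħ`; so `I u ∈ ħ V` forces `u ∈ ħ U_ħ`
(`IsQuantization.isEquivMod`). A basis of `g` carries both facts to `I ⊗ 1` (`IsEquivMod.tensor`).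
This yields existence and uniqueness of the two products and reduces every identity to `Ud_ħ(g)`.

There, `Ud_ħ(g)` is a `U_ħ`-bimodule, `f ⊗ x ↦ f x̄` is a bimodule map to `U_ħ`, and the products
are `ā · b` and `a · b̄`; the dialgebra axioms are then formal. The commutator `u · b - b · u` obeys
a Leibniz rule in `u`, as does the Loday–Poisson action, so its limit is found by induction from
generators (`exists_smul_sub_rmul`), where the semiclassical limit of the star product enters.

A star product is built from Gutt's formula: with `D = ∑ ∂ᵢ ⊗ ad eᵢ` and `m` the multiplication, let
`x` act on `f` by `∑ (Bₙ / n!) ħⁿ m (Dⁿ (f ⊗ x))`. The commutation relation `gutt_comm` reduces to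
the functional equation of `t / (e^t - 1)` in two commuting operators (`bern_identity`). So `U_ħ`
acts on `S(L)[[ħ]]`, the orbit map of `1` satisfies `IsEquivMod`, and the product of `U_ħ` is
transported along it. -/

theorem mem_span_pow_smul_top {n : ℕ} {x : M} :
    x ∈ (Ideal.span {h} ^ n • ⊤ : Submodule R M) ↔ ∃ y : M, x = h ^ n • y := by
  rw [Ideal.span_singleton_pow, Submodule.ideal_span_singleton_smul,
    Submodule.mem_smul_pointwise_iff_exists]
  simp [eq_comm]

/-- For a principal ideal, congruences become explicit multiples of `h ^ n`, and the Cauchy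
condition need only be tested on consecutive terms, because `h ^ m` divides `h ^ n` for `m ≤ n`. -/
theorem isAdicComplete_span_iff :
    IsAdicComplete (Ideal.span {h}) M ↔
      (∀ x : M, (∀ n : ℕ, ∃ y, x = h ^ n • y) → x = 0) ∧
      (∀ f : ℕ → M, (∀ n, ∃ y, f (n + 1) - f n = h ^ n • y) →
        ∃ l, ∀ n, ∃ y, f n - l = h ^ n • y) := by
  constructor
  · intro hM
    refine ⟨fun x hx => hM.haus x fun n => ?_, fun f hf => ?_⟩
    · rw [SModEq.zero, mem_span_pow_smul_top]
      exact hx n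
    · obtain ⟨l, hl⟩ := hM.prec (f := f) (by
        intro m n hmn
        induction n, hmn using Nat.le_induction with
        | base => rfl
        | succ n hmn ih =>
          refine ih.trans (SModEq.symm ?_)
          rw [SModEq.sub_mem, mem_span_pow_smul_top]
          obtain ⟨y, hy⟩ := hf n
          refine ⟨h ^ (n - m) • y, ?_⟩
          rw [hy, smul_smul, ← pow_add, Nat.add_sub_cancel' hmn])
      refine ⟨l, fun n => ?_⟩
      rw [← mem_span_pow_smul_top, ← SModEq.sub_mem]
      exact hl n
  · rintro ⟨h1, h2⟩
    refine { haus' := fun x hx => h1 x fun n => ?_, prec' := fun f hf => ?_ }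
    · rw [← mem_span_pow_smul_top, ← SModEq.zero]
      exact hx n
    · obtain ⟨l, hl⟩ := h2 f fun n => by
        rw [← mem_span_pow_smul_top, ← SModEq.sub_mem]
        exact (hf n.le_succ).symm
      refine ⟨l, fun n => ?_⟩
      rw [SModEq.sub_mem, mem_span_pow_smul_top]
      exact hl n

theorem IsAdicComplete.of_linearEquiv (e : M ≃ₗ[R] N) (hM : IsAdicComplete (Ideal.span {h}) M) :
    IsAdicComplete (Ideal.span {h}) N := by
  rw [isAdicComplete_span_iff] at hM ⊢
  refine ⟨fun x hx => ?_, fun f hf => ?_⟩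
  · rw [← e.symm.map_eq_zero_iff]
    refine hM.1 _ fun n => ?_
    obtain ⟨y, rfl⟩ := hx n
    exact ⟨e.symm y, by simp⟩
  · obtain ⟨l, hl⟩ := hM.2 (fun n => e.symm (f n)) fun n => by
      obtain ⟨y, hy⟩ := hf n
      exact ⟨e.symm y, by rw [← map_sub, hy, map_smul]⟩
    refine ⟨e l, fun n => ?_⟩
    obtain ⟨y, hy⟩ := hl n
    exact ⟨e y, by rw [← map_smul, ← hy]; simp⟩

theorem IsAdicComplete.pi {ι : Type*} (hM : IsAdicComplete (Ideal.span {h}) M) :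
    IsAdicComplete (Ideal.span {h}) (ι → M) := by
  rw [isAdicComplete_span_iff] at hM ⊢
  refine ⟨fun x hx => funext fun i => hM.1 _ fun n => ?_, fun f hf => ?_⟩
  · obtain ⟨y, rfl⟩ := hx n
    exact ⟨y i, rfl⟩
  · choose y hy using hf
    choose l z hz using fun i => hM.2 (fun n => f n i) fun n => ⟨y n i, congrFun (hy n) i⟩
    exact ⟨l, fun n => ⟨fun i => z i n, funext fun i => hz i n⟩⟩

/-- A linear map `j` into an `h`-torsion free module that is an isomorphism modulo `h`. -/
structure IsEquivMod (h : R) (j : U →ₗ[R] V) : Prop where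
  surj : ∀ v, ∃ u v', v = j u + h • v'
  inj : ∀ u v, j u = h • v → ∃ u', u = h • u'
  torsion_free : ∀ v : V, h • v = 0 → v = 0

namespace IsEquivMod

variable {j : U →ₗ[R] V} (hj : IsEquivMod h j)

include hj in
theorem surj_pow (n : ℕ) (v : V) : ∃ u v', v = j u + h ^ n • v' := by
  induction n with
  | zero => exact ⟨0, v, by simp⟩
  | succ n ih =>
    obtain ⟨u, v', rfl⟩ := ih
    obtain ⟨u', v'', rfl⟩ := hj.surj v'
    exact ⟨u + h ^ n • u', v'', by simp [pow_succ, mul_smul, add_assoc]⟩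

include hj in
-- Injectivity modulo `h` extracts one factor of `h` from `u`; torsion-freeness of `V` cancels that
-- factor in the equation, and the argument repeats.
theorem inj_pow (n : ℕ) (u : U) (v : V) (huv : j u = h ^ n • v) : ∃ u', u = h ^ n • u' := by
  induction n generalizing u v with
  | zero => exact ⟨u, by simp⟩
  | succ n ih =>
    obtain ⟨u', rfl⟩ := hj.inj u (h ^ n • v) (by rw [huv, smul_smul, pow_succ'])
    obtain ⟨w, rfl⟩ := ih u' v (by
      rw [← sub_eq_zero]
      refine hj.torsion_free _ ?_
      rw [smul_sub, ← map_smul, huv, smul_smul, pow_succ', sub_self])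
    exact ⟨w, by rw [smul_smul, pow_succ']⟩

include hj in
theorem reduceModIdeal_bijective (n : ℕ) :
    Function.Bijective (j.reduceModIdeal (Ideal.span {h} ^ n)) := by
  constructor
  · rw [injective_iff_map_eq_zero]
    intro x hx
    obtain ⟨u, rfl⟩ := Submodule.Quotient.mk_surjective _ x
    rw [LinearMap.reduceModIdeal_apply, Submodule.Quotient.mk_eq_zero,
      mem_span_pow_smul_top] at hx
    obtain ⟨v, hv⟩ := hx
    rw [Submodule.Quotient.mk_eq_zero, mem_span_pow_smul_top]
    exact hj.inj_pow n u v hv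
  · intro y
    obtain ⟨v, rfl⟩ := Submodule.Quotient.mk_surjective _ y
    obtain ⟨u, v', rfl⟩ := hj.surj_pow n v
    refine ⟨Submodule.Quotient.mk u, ?_⟩
    rw [LinearMap.reduceModIdeal_apply, Submodule.Quotient.eq, mem_span_pow_smul_top]
    exact ⟨-v', by simp⟩

include hj in
theorem adicCompletion_map_bijective :
    Function.Bijective (AdicCompletion.map (Ideal.span {h}) j) := by
  constructor
  · intro x y hxy
    refine AdicCompletion.ext fun n => (hj.reduceModIdeal_bijective n).1 ?_
    rw [← AdicCompletion.map_val_apply, hxy, AdicCompletion.map_val_apply]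
  · intro y
    choose x hx using fun n => (hj.reduceModIdeal_bijective n).2 (y.val n)
    -- The levelwise preimages are compatible because their images are, and level `m` is injective.
    refine ⟨⟨x, fun {m n} hmn => (hj.reduceModIdeal_bijective m).1 ?_⟩, AdicCompletion.ext hx⟩
    have := LinearMap.congr_fun
      (AdicCompletion.transitionMap_comp_reduceModIdeal (Ideal.span {h}) j hmn) (x n)
    rw [hx m, ← y.property hmn, ← hx n]
    exact this.symm

variable (hM : IsAdicComplete (Ideal.span {h}) M)

include hj hM in
theorem hom_ext {φ ψ : V →ₗ[R] M} (H : ∀ u, φ (j u) = ψ (j u)) : φ = ψ := by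
  ext v
  rw [← sub_eq_zero]
  refine (isAdicComplete_span_iff.1 hM).1 _ fun n => ?_
  obtain ⟨u, v', rfl⟩ := hj.surj_pow n v
  exact ⟨φ v' - ψ v', by simp [H, smul_sub]⟩

include hj hM in
-- `m` is the limit of `φ u` over approximations `j u` of `v`. Quantifying over all approximations,
-- not only a chosen sequence, is what makes linearity of the extension easy to check.
theorem exists_limit (φ : U →ₗ[R] M) (v : V) :
    ∃ m : M, ∀ n u v', v = j u + h ^ n • v' → ∃ m', φ u = m + h ^ n • m' := by
  choose u v' huv using fun n => hj.surj_pow n v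
  -- Two approximations of the same vector modulo `h ^ n` differ by an element of `h ^ n U`, so
  -- their values under `φ` agree modulo `h ^ n`.
  have key : ∀ n u₁ u₂ v₁ v₂, j u₁ + h ^ n • v₁ = j u₂ + h ^ n • v₂ →
      ∃ y, φ u₁ - φ u₂ = h ^ n • y := by
    intro n u₁ u₂ v₁ v₂ H
    obtain ⟨w, hw⟩ := hj.inj_pow n (u₁ - u₂) (v₂ - v₁) (by
      rw [map_sub, smul_sub, sub_eq_sub_iff_add_eq_add, H, add_comm])
    exact ⟨φ w, by rw [← map_sub, hw, map_smul]⟩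
  obtain ⟨m, hm⟩ := (isAdicComplete_span_iff.1 hM).2 (fun n => φ (u n)) fun n => by
    refine key n _ _ (h • v' (n + 1)) (v' n) ?_
    rw [← huv n, smul_smul, ← pow_succ, ← huv (n + 1)]
  refine ⟨m, fun n w w' hw => ?_⟩
  obtain ⟨y, hy⟩ := hm n
  obtain ⟨z, hz⟩ := key n w (u n) w' (v' n) (by rw [← hw, ← huv n])
  exact ⟨y + z, by rw [smul_add, ← hy, ← hz]; abel⟩

/-- The extension along `j` of a linear map into a complete module. -/
def extend (φ : U →ₗ[R] M) : V →ₗ[R] M :=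
  -- Since `M` is separated, the approximation property determines the limit; each linearity law
  -- follows by verifying it for the expected value.
  have uniq : ∀ v m, (∀ n u v', v = j u + h ^ n • v' → ∃ m', φ u = m + h ^ n • m') →
      (hj.exists_limit hM φ v).choose = m := by
    intro v m H
    rw [← sub_eq_zero]
    refine (isAdicComplete_span_iff.1 hM).1 _ fun n => ?_
    obtain ⟨u, v', huv⟩ := hj.surj_pow n v
    obtain ⟨a, ha⟩ := (hj.exists_limit hM φ v).choose_spec n u v' huv
    obtain ⟨b, hb⟩ := H n u v' huv
    refine ⟨b - a, ?_⟩
    rw [smul_sub, sub_eq_sub_iff_add_eq_add, ← ha, hb, add_comm]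
  { toFun := fun v => (hj.exists_limit hM φ v).choose
    map_add' := fun v w => by
      refine uniq _ _ fun n u v' huv => ?_
      obtain ⟨u₁, v₁, h₁⟩ := hj.surj_pow n v
      obtain ⟨a, ha⟩ := (hj.exists_limit hM φ v).choose_spec n u₁ v₁ h₁
      -- If `u` approximates `v + w` and `u₁` approximates `v`, then `u - u₁` approximates `w`.
      obtain ⟨b, hb⟩ := (hj.exists_limit hM φ w).choose_spec n (u - u₁) (v' - v₁) (by
        rw [map_sub, smul_sub, sub_add_sub_comm, ← huv, ← h₁, add_sub_cancel_left])
      refine ⟨a + b, ?_⟩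
      rw [smul_add, add_add_add_comm, ← ha, ← hb, map_sub, add_sub_cancel]
    map_smul' := fun c v => by
      refine uniq _ _ fun n u v' huv => ?_
      obtain ⟨u₁, v₁, h₁⟩ := hj.surj_pow n v
      obtain ⟨a, ha⟩ := (hj.exists_limit hM φ v).choose_spec n u₁ v₁ h₁
      obtain ⟨w, hw⟩ := hj.inj_pow n (u - c • u₁) (c • v₁ - v') (by
        rw [map_sub, map_smul, smul_sub, sub_eq_sub_iff_add_eq_add, ← huv, h₁, smul_add,
          smul_comm c, add_comm])
      refine ⟨c • a + φ w, ?_⟩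
      rw [smul_add, ← map_smul φ, ← hw, smul_comm, RingHom.id_apply, ← add_assoc, ← smul_add,
        ← ha, map_sub, map_smul, add_sub_cancel] }

theorem extend_apply (φ : U →ₗ[R] M) (u : U) : hj.extend hM φ (j u) = φ u := by
  rw [← sub_eq_zero]
  refine (isAdicComplete_span_iff.1 hM).1 _ fun n => ?_
  -- At every level `u` itself approximates `j u`, with remainder `0`.
  obtain ⟨a, ha⟩ := (hj.exists_limit hM φ (j u)).choose_spec n u 0 (by simp)
  refine ⟨-a, ?_⟩
  rw [ha, smul_neg]
  change (hj.exists_limit hM φ (j u)).choose - _ = _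
  abel

/-- Extension along `j` as a linear map. -/
def extendHom : (U →ₗ[R] M) →ₗ[R] (V →ₗ[R] M) where
  toFun := hj.extend hM
  map_add' φ ψ := hj.hom_ext hM fun u => by simp [extend_apply]
  map_smul' c φ := hj.hom_ext hM fun u => by simp [extend_apply]

/-- The extension along `j` of a bilinear map into a complete module. -/
def extend₂ (β : U →ₗ[R] U →ₗ[R] M) : V →ₗ[R] V →ₗ[R] M :=
  (hj.extendHom hM ∘ₗ (hj.extendHom hM ∘ₗ β).flip).flip

theorem extend₂_apply (β : U →ₗ[R] U →ₗ[R] M) (u v : U) :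
    hj.extend₂ hM β (j u) (j v) = β u v := by
  change hj.extend hM ((hj.extendHom hM ∘ₗ β).flip (j v)) (j u) = β u v
  rw [extend_apply]
  exact hj.extend_apply hM (β u) v

include hj hM in
theorem hom_ext₂ {φ ψ : V →ₗ[R] V →ₗ[R] M} (H : ∀ u v, φ (j u) (j v) = ψ (j u) (j v)) :
    φ = ψ := by
  rw [← φ.flip_flip, ← ψ.flip_flip]
  congr 1
  ext v w
  exact LinearMap.congr_fun (hj.hom_ext hM (φ := φ.flip v) (ψ := ψ.flip v) fun u =>
    LinearMap.congr_fun (hj.hom_ext hM (H u)) v) w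

include hj hM in
theorem hom_ext₃ {φ ψ : V →ₗ[R] V →ₗ[R] V →ₗ[R] M}
    (H : ∀ u v w, φ (j u) (j v) (j w) = ψ (j u) (j v) (j w)) : φ = ψ := by
  ext a b c
  have h₁ : ∀ u, φ (j u) = ψ (j u) := fun u => hj.hom_ext₂ hM (H u)
  exact LinearMap.congr_fun (hj.hom_ext hM (φ := (φ.flip b).flip c) (ψ := (ψ.flip b).flip c)
    fun u => by simp [h₁]) a

end IsEquivMod

end Adic

/-! ### Power series modules -/

section SymH

variable {k L : Type*} [Field k] [LieRing L] [LieAlgebra k L]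

theorem smul_eq_map_mul (r : k⟦X⟧) (f : SymH k L) :
    r • f = PowerSeries.map (algebraMap k (Sym k L)) r * f := rfl

theorem hbar_smul_eq (f : SymH k L) : hbar k • f = PowerSeries.X * f := by
  rw [smul_eq_map_mul, PowerSeries.map_X]

theorem coeff_zero_hbar_smul (f : SymH k L) : PowerSeries.coeff 0 (hbar k • f) = 0 := by
  rw [hbar_smul_eq, PowerSeries.coeff_zero_X_mul]

theorem coeff_succ_hbar_smul (n : ℕ) (f : SymH k L) :
    PowerSeries.coeff (n + 1) (hbar k • f) = PowerSeries.coeff n f := by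
  rw [hbar_smul_eq, PowerSeries.coeff_succ_X_mul]

theorem coeff_zero_smul (r : k⟦X⟧) (f : SymH k L) :
    PowerSeries.coeff 0 (r • f) = PowerSeries.coeff 0 r • PowerSeries.coeff 0 f := by
  rw [smul_eq_map_mul, Algebra.smul_def, PowerSeries.coeff_mul, Finset.Nat.antidiagonal_zero,
    Finset.sum_singleton, PowerSeries.coeff_map]

theorem coeff_hbar_pow_smul (n m : ℕ) (f : SymH k L) :
    PowerSeries.coeff m (hbar k ^ n • f) = if n ≤ m then PowerSeries.coeff (m - n) f else 0 := by
  rw [smul_eq_map_mul, map_pow, PowerSeries.map_X, PowerSeries.coeff_X_pow_mul']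

theorem hbar_smul_injective {f : SymH k L} (hf : hbar k • f = 0) : f = 0 := by
  ext n
  rw [← coeff_succ_hbar_smul, hf]
  simp

theorem eq_const_add (f : SymH k L) :
    ∃ f', f = const k L (PowerSeries.coeff 0 f) + hbar k • f' := by
  refine ⟨PowerSeries.mk fun n => PowerSeries.coeff (n + 1) f, ?_⟩
  ext n
  rw [map_add]
  cases n with
  | zero => rw [coeff_zero_hbar_smul]; simp [const]
  | succ n => rw [coeff_succ_hbar_smul]; simp [const]

theorem coeff_zero_const (f : Sym k L) : PowerSeries.coeff 0 (const k L f) = f := by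
  simp [const]

theorem const_one : const k L 1 = 1 := rfl

theorem isAdicComplete_symH : IsAdicComplete (Ideal.span {hbar k}) (SymH k L) := by
  rw [isAdicComplete_span_iff]
  refine ⟨fun f hf => ?_, fun f hf => ?_⟩
  · ext n
    obtain ⟨y, hy⟩ := hf (n + 1)
    rw [hy, coeff_hbar_pow_smul]
    simp
  · have stab : ∀ n m i, i < n → PowerSeries.coeff i (f (n + m)) = PowerSeries.coeff i (f n) := by
      intro n m i hi
      induction m with
      | zero => rfl
      | succ m ih =>
        obtain ⟨y, hy⟩ := hf (n + m)
        rw [← ih, ← sub_eq_zero, ← map_sub, ← add_assoc, hy, coeff_hbar_pow_smul,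
          if_neg (by omega)]
    -- Congruence modulo `ħ ^ n` fixes only degrees below `n`, so the coefficient of degree `n` is
    -- read off from the term of index `n + 1`.
    refine ⟨PowerSeries.mk fun n => PowerSeries.coeff n (f (n + 1)), fun n => ?_⟩
    refine ⟨PowerSeries.mk fun i => PowerSeries.coeff (i + n) (f n) -
      PowerSeries.coeff (i + n) (f (i + n + 1)), ?_⟩
    ext i
    rw [coeff_hbar_pow_smul, map_sub, PowerSeries.coeff_mk, PowerSeries.coeff_mk]
    split_ifs with hi
    · rw [Nat.sub_add_cancel hi]
    · obtain ⟨m, rfl⟩ := Nat.exists_eq_add_of_le (Nat.succ_le_of_lt (not_le.1 hi))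
      rw [Nat.succ_eq_add_one, stab (i + 1) m i (Nat.lt_succ_self i), sub_self]

end SymH

theorem eq_smul_one_add_hbar {k : Type*} [Field k] (r : k⟦X⟧) :
    ∃ r', r = algebraMap k (k⟦X⟧) (PowerSeries.coeff 0 r) + hbar k * r' := by
  refine ⟨PowerSeries.mk fun n => PowerSeries.coeff (n + 1) r, ?_⟩
  ext n
  cases n <;> simp [PowerSeries.coeff_succ_X_mul]

/-! ### The enveloping algebra modulo `ħ` -/

section Enveloping

variable {k L : Type*} [Field k] [LieRing L] [LieAlgebra k L]

/-- Induction principle for `U_ħ(L)`: it is generated by `L` as an algebra. -/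
theorem uh_induction {p : Uh k L → Prop} (one : p 1) (gen : ∀ x, p (ugen k L x))
    (add : ∀ u v, p u → p v → p (u + v)) (smul : ∀ (r : k⟦X⟧) u, p u → p (r • u))
    (mul : ∀ u v, p u → p v → p (u * v)) (u : Uh k L) : p u := by
  let A : Subalgebra (k⟦X⟧) (Uh k L) :=
    { carrier := {u | p u}
      mul_mem' := fun ha hb => mul _ _ ha hb
      add_mem' := fun ha hb => add _ _ ha hb
      algebraMap_mem' := fun r => by
        rw [Algebra.algebraMap_eq_smul_one]
        exact smul r 1 one }
  let f : Uh k L →ₐ[k⟦X⟧] A :=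
    UniversalEnvelopingAlgebra.lift (k⟦X⟧)
      { toFun := fun m => ⟨UniversalEnvelopingAlgebra.ι (k⟦X⟧) m, by
          obtain ⟨m, rfl⟩ := (rescale (k⟦X⟧) (k⟦X⟧ ⊗[k] L) (hbar k)).surjective m
          induction m with
          | zero => simp only [map_zero]; exact A.zero_mem
          | add a b ha hb => rw [map_add, map_add]; exact A.add_mem ha hb
          | tmul r x =>
            have : rescale (k⟦X⟧) (k⟦X⟧ ⊗[k] L) (hbar k) (r ⊗ₜ x) =
                r • rescale (k⟦X⟧) (k⟦X⟧ ⊗[k] L) (hbar k) (1 ⊗ₜ x) := by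
              rw [← map_smul, TensorProduct.smul_tmul', smul_eq_mul, mul_one]
            rw [this, map_smul]
            exact A.smul_mem (gen x) r⟩
        map_add' := fun a b => Subtype.ext (map_add _ a b)
        map_smul' := fun r a => Subtype.ext (map_smul _ r a)
        map_lie' := fun {a b} => Subtype.ext
          ((UniversalEnvelopingAlgebra.ι (k⟦X⟧) : HLie k L →ₗ⁅k⟦X⟧⁆ Uh k L).map_lie a b) }
  -- The elements with property `p` form a subalgebra `A`. The map into `A` given by the universal
  -- property, followed by the inclusion, fixes the generators and hence everything, so `A` is the
  -- whole algebra.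
  have hf : A.val.comp f = AlgHom.id _ _ := by
    apply UniversalEnvelopingAlgebra.hom_ext
    ext m
    change (f (UniversalEnvelopingAlgebra.ι (k⟦X⟧) m) : Uh k L) = _
    rw [UniversalEnvelopingAlgebra.lift_ι_apply]
    rfl
  have : u = f u := (DFunLike.congr_fun hf u).symm
  rw [this]
  exact (f u).2

variable (k L) in
/-- Congruence modulo `ħ` on `U_ħ(L)`. -/
def modHbar : RingCon (Uh k L) where
  r a b := ∃ w, a - b = hbar k • w
  iseqv :=
    { refl := fun a => ⟨0, by simp⟩
      symm := fun ⟨w, hw⟩ => ⟨-w, by rw [smul_neg, ← hw, neg_sub]⟩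
      trans := fun ⟨v, hv⟩ ⟨w, hw⟩ => ⟨v + w, by rw [smul_add, ← hv, ← hw, sub_add_sub_cancel]⟩ }
  add' := fun ⟨v, hv⟩ ⟨w, hw⟩ => ⟨v + w, by rw [smul_add, ← hv, ← hw, add_sub_add_comm]⟩
  mul' := fun {a b c d} ⟨v, hv⟩ ⟨w, hw⟩ => ⟨v * c + b * w, by
    rw [smul_add, ← smul_mul_assoc, ← mul_smul_comm, ← hv, ← hw, sub_mul, mul_sub]
    abel⟩

theorem modHbar_iff {a b : Uh k L} :
    (a : (modHbar k L).Quotient) = b ↔ ∃ w, a - b = hbar k • w :=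
  (modHbar k L).eq

/-- Commutators of generators carry a factor `ħ`, and a commutator is a derivation in each argument.
The resulting commutativity of the quotient is what allows `S(L)` to map to it. -/
theorem modHbar_commute (a b : Uh k L) : ∃ w, a * b - b * a = hbar k • w := by
  induction a using uh_induction with
  | one => exact ⟨0, by simp⟩
  | gen x =>
    induction b using uh_induction with
    | one => exact ⟨0, by simp⟩
    | gen y => exact ⟨_, ugen_comm k L x y⟩
    | add u v hu hv =>
      obtain ⟨p, hp⟩ := hu
      obtain ⟨q, hq⟩ := hv
      exact ⟨p + q, by rw [mul_add, add_mul, smul_add, ← hp, ← hq, add_sub_add_comm]⟩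
    | smul r u hu =>
      obtain ⟨p, hp⟩ := hu
      exact ⟨r • p, by rw [mul_smul_comm, smul_mul_assoc, ← smul_sub, hp, smul_comm]⟩
    | mul u v hu hv =>
      obtain ⟨p, hp⟩ := hu
      obtain ⟨q, hq⟩ := hv
      refine ⟨p * v + u * q, ?_⟩
      rw [smul_add, ← smul_mul_assoc, ← mul_smul_comm, ← hp, ← hq]
      noncomm_ring
  | add u v hu hv =>
    obtain ⟨p, hp⟩ := hu
    obtain ⟨q, hq⟩ := hv
    exact ⟨p + q, by rw [mul_add, add_mul, smul_add, ← hp, ← hq, add_sub_add_comm]⟩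
  | smul r u hu =>
    obtain ⟨p, hp⟩ := hu
    exact ⟨r • p, by rw [mul_smul_comm, smul_mul_assoc, ← smul_sub, hp, smul_comm]⟩
  | mul u v hu hv =>
    obtain ⟨p, hp⟩ := hu
    obtain ⟨q, hq⟩ := hv
    refine ⟨p * v + u * q, ?_⟩
    rw [smul_add, ← smul_mul_assoc, ← mul_smul_comm, ← hp, ← hq]
    noncomm_ring

variable (k L) in
/-- The commutative algebra `U_ħ(L) / ħ U_ħ(L)`. -/
def UhModHbar : Type _ := (modHbar k L).Quotient

instance : Ring (UhModHbar k L) := inferInstanceAs (Ring (modHbar k L).Quotient)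

instance : CommRing (UhModHbar k L) :=
  { (inferInstance : Ring (UhModHbar k L)) with
    mul_comm := fun a b => by
      obtain ⟨a, rfl⟩ := Quotient.exists_rep a
      obtain ⟨b, rfl⟩ := Quotient.exists_rep b
      exact modHbar_iff.2 (modHbar_commute a b) }

variable (k L) in
/-- The projection `U_ħ(L) → U_ħ(L) / ħ U_ħ(L)`. -/
def toMod : Uh k L →+* UhModHbar k L := (modHbar k L).mk'

instance : Algebra k (UhModHbar k L) :=
  ((toMod k L).comp (algebraMap k (Uh k L))).toAlgebra

theorem toMod_smul (c : k) (u : Uh k L) : toMod k L (c • u) = c • toMod k L u := by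
  rw [Algebra.smul_def, Algebra.smul_def, map_mul]
  rfl

theorem toMod_eq_zero {u : Uh k L} : toMod k L u = 0 ↔ ∃ w, u = hbar k • w := by
  rw [← map_zero (toMod k L)]
  refine modHbar_iff.trans ?_
  simp

variable (k L) in
/-- The algebra map `S(L) → U_ħ(L) / ħ U_ħ(L)`. -/
def symToMod : Sym k L →ₐ[k] UhModHbar k L :=
  SymmetricAlgebra.lift
    { toFun := fun x => toMod k L (ugen k L x)
      map_add' := fun x y => by rw [map_add, map_add]
      map_smul' := fun c x => by rw [map_smul, toMod_smul, RingHom.id_apply] }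

theorem symToMod_gen (x : L) : symToMod k L (gen k L x) = toMod k L (ugen k L x) := by
  simp [symToMod]

/-- A linear map `U_ħ(L) → S(L)[[ħ]]` whose constant term is multiplicative and is the identity
on generators. -/
structure IsQuantization (j : Uh k L →ₗ[k⟦X⟧] SymH k L) : Prop where
  coeff_one : PowerSeries.coeff 0 (j 1) = 1
  coeff_mul : ∀ u v, PowerSeries.coeff 0 (j (u * v)) =
    PowerSeries.coeff 0 (j u) * PowerSeries.coeff 0 (j v)
  coeff_gen : ∀ x, PowerSeries.coeff 0 (j (ugen k L x)) = gen k L x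

namespace IsQuantization

variable {j : Uh k L →ₗ[k⟦X⟧] SymH k L} (hj : IsQuantization j)

include hj in
-- Both sides are multiplicative in `u` and agree on generators. This left inverse modulo `ħ` gives
-- injectivity and replaces the Poincaré–Birkhoff–Witt theorem.
theorem symToMod_coeff (u : Uh k L) :
    symToMod k L (PowerSeries.coeff 0 (j u)) = toMod k L u := by
  induction u using uh_induction with
  | one => rw [hj.coeff_one, map_one, map_one]
  | gen x => rw [hj.coeff_gen, symToMod_gen]
  | add u v hu hv => rw [map_add, map_add, map_add, hu, hv, map_add]
  | smul r u hu =>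
    rw [map_smul, coeff_zero_smul, map_smul, hu, ← toMod_smul, ← sub_eq_zero, ← map_sub,
      toMod_eq_zero]
    -- A scalar series and its constant term act alike modulo `ħ`.
    obtain ⟨r', hr'⟩ := eq_smul_one_add_hbar r
    refine ⟨-(r' • u), ?_⟩
    conv_lhs => rw [hr', add_smul, mul_smul]
    rw [algebraMap_smul, ← hr', smul_neg]
    abel
  | mul u v hu hv => rw [hj.coeff_mul, map_mul, hu, hv, map_mul]

include hj in
theorem coeff_surjective (f : Sym k L) : ∃ u, PowerSeries.coeff 0 (j u) = f := by
  induction f using SymmetricAlgebra.induction with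
  | algebraMap r =>
    refine ⟨algebraMap k (k⟦X⟧) r • 1, ?_⟩
    rw [map_smul, coeff_zero_smul, hj.coeff_one, Algebra.algebraMap_eq_smul_one,
      Algebra.algebraMap_eq_smul_one]
    simp
  | ι x => exact ⟨_, hj.coeff_gen x⟩
  | mul a b ha hb =>
    obtain ⟨u, rfl⟩ := ha
    obtain ⟨v, rfl⟩ := hb
    exact ⟨_, hj.coeff_mul u v⟩
  | add a b ha hb =>
    obtain ⟨u, rfl⟩ := ha
    obtain ⟨v, rfl⟩ := hb
    exact ⟨u + v, by rw [map_add, map_add]⟩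

include hj in
theorem isEquivMod : IsEquivMod (hbar k) j where
  surj f := by
    obtain ⟨u, hu⟩ := hj.coeff_surjective (PowerSeries.coeff 0 f)
    obtain ⟨f', hf'⟩ := eq_const_add f
    obtain ⟨g', hg'⟩ := eq_const_add (j u)
    refine ⟨u, f' - g', ?_⟩
    rw [hg', hu, smul_sub, add_add_sub_cancel]
    exact hf'
  inj u f huf := by
    rw [← toMod_eq_zero, ← hj.symToMod_coeff, huf, coeff_zero_hbar_smul, map_zero]
  torsion_free _ := hbar_smul_injective

end IsQuantization

/-! ### Star products -/

theorem StarProduct.coeff_zero_mul (P : StarProduct k L) (f h : SymH k L) :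
    PowerSeries.coeff 0 (P.mul f h) = PowerSeries.coeff 0 f * PowerSeries.coeff 0 h := by
  obtain ⟨f', hf'⟩ := eq_const_add f
  obtain ⟨h', hh'⟩ := eq_const_add h
  conv_lhs => rw [hf', hh']
  simp only [map_add, map_smul, LinearMap.add_apply, LinearMap.smul_apply, coeff_zero_hbar_smul,
    P.classical_limit, add_zero]

variable (P : StarProduct k L)

/-- The linear map underlying `I : U_ħ(L) → S_⋆(L)`. -/
def starLin : Uh k L →ₗ[k⟦X⟧] SymH k L :=
  (StarAlg.of P).symm.toLinearMap ∘ₗ (starHom P).toLinearMap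

theorem starLin_mul (u v : Uh k L) : starLin P (u * v) = P.mul (starLin P u) (starLin P v) := by
  simp [starLin, StarAlg.mul_def]

theorem starLin_one : starLin P 1 = 1 := by
  simp [starLin, StarAlg.one_def]

theorem starLin_ugen (x : L) : starLin P (ugen k L x) = const k L (gen k L x) := by
  simp [starLin, starHom, ulift_ugen]

theorem isQuantization_starLin : IsQuantization (starLin P) where
  coeff_one := by rw [starLin_one]; simp
  coeff_mul u v := by rw [starLin_mul, P.coeff_zero_mul]
  coeff_gen x := by rw [starLin_ugen, coeff_zero_const]

end Enveloping

/-! ### The functional equation of `t / (e^t - 1)` -/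

section Bernoulli

open PowerSeries in
-- Write `x = e^{sX}`, `y = e^{tX}`. After multiplication by `(x - 1)(y - 1)(xy - 1)`, nonzero in a
-- domain, the claim follows from the three relations of the form `B(rX) (e^{rX} - 1) = rX` and from
-- `(x - 1) + (y - 1) - (xy - 1) = -(x - 1)(y - 1)`.
theorem bernoulliPowerSeries_rescale_identity {R : Type*} [CommRing R] [IsDomain R] [Algebra ℚ R]
    {s t : R} (hs : s ≠ 0) (ht : t ≠ 0) (hst : s + t ≠ 0) :
    C t * (PowerSeries.rescale s (bernoulliPowerSeries R) *
        (PowerSeries.rescale (s + t) (bernoulliPowerSeries R) - PowerSeries.rescale t (bernoulliPowerSeries R))) +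
      C s * (PowerSeries.rescale t (bernoulliPowerSeries R) *
        (PowerSeries.rescale (s + t) (bernoulliPowerSeries R) - PowerSeries.rescale s (bernoulliPowerSeries R))) =
      -(X * (C (s * t) * PowerSeries.rescale (s + t) (bernoulliPowerSeries R))) := by
  have key : ∀ r : R, PowerSeries.rescale r (bernoulliPowerSeries R) * (PowerSeries.rescale r (exp R) - 1) = C r * X := by
    intro r
    rw [← rescale_X, ← bernoulliPowerSeries_mul_exp_sub_one, map_mul, map_sub, map_one]
  have ne : ∀ {r : R}, r ≠ 0 → PowerSeries.rescale r (exp R) - 1 ≠ 0 := by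
    intro r hr h0
    have := key r
    rw [h0, mul_zero, eq_comm, mul_eq_zero] at this
    rcases this with h | h
    · exact hr (by simpa using congrArg (coeff 0) h)
    · exact X_ne_zero h
  have hA := key s
  have hB := key t
  have hC := key (s + t)
  have nA := ne hs
  have nB := ne ht
  have nC := ne hst
  rw [← exp_mul_exp_eq_exp_add] at hC nC
  rw [map_add] at hC
  rw [map_mul]
  generalize PowerSeries.rescale s (bernoulliPowerSeries R) = A at *
  generalize PowerSeries.rescale t (bernoulliPowerSeries R) = B at *
  generalize PowerSeries.rescale (s + t) (bernoulliPowerSeries R) = D at *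
  generalize PowerSeries.rescale s (exp R) = x at *
  generalize PowerSeries.rescale t (exp R) = y at *
  refine mul_left_cancel₀ (mul_ne_zero (mul_ne_zero nA nB) nC) ?_
  generalize C s = s at *
  generalize C t = t at *
  linear_combination
    (t * (y - 1) * (x * y - 1) * (D - B) - s * (y - 1) * (x * y - 1) * B) * hA +
    (s * (x - 1) * (x * y - 1) * D - (s + t) * s * X * (x * y - 1)) * hB +
    (t * (y - 1) * s * X + s * (x - 1) * t * X + s * t * X * (x - 1) * (y - 1)) * hC

variable {k : Type*} [Field k] [CharZero k]

variable (k) in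
/-- The coefficients `Bₙ / n!` of `t / (e^t - 1)`. -/
def bern (n : ℕ) : k := algebraMap ℚ k (bernoulli n / n.factorial)

theorem bern_zero : bern k 0 = 1 := by simp [bern]

theorem bern_one : bern k 1 = -(2 : k)⁻¹ := by
  rw [bern, bernoulli_one]
  simp [neg_div]

/-- The noncommutative form of `((a + b)^p - b^p) / a`. -/
def divDiff {A : Type*} [Semiring A] (p : ℕ) (a b : A) : A :=
  ∑ i ∈ Finset.range p, (a + b) ^ i * b ^ (p - 1 - i)

theorem divDiff_mul {A : Type*} [CommRing A] (p : ℕ) (a b : A) :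
    divDiff p a b * a = (a + b) ^ p - b ^ p := by
  rw [divDiff, ← geom_sum₂_mul (a + b) b p, add_sub_cancel_right]

/-- This is the coefficient of `X ^ (n + 1)` in the power series identity, divided by `s t`; the
quotients of `(s + t) ^ p - t ^ p` by `s` and of `(s + t) ^ p - s ^ p` by `t` are the `divDiff`
terms. -/
theorem bern_identity_domain {R : Type*} [CommRing R] [IsDomain R] [Algebra ℚ R] [Algebra k R]
    {s t : R} (hs : s ≠ 0) (ht : t ≠ 0) (hst : s + t ≠ 0) (n : ℕ) :
    ∑ pq ∈ Finset.HasAntidiagonal.antidiagonal (n + 1), algebraMap k R (bern k pq.1 * bern k pq.2) *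
      (divDiff pq.2 s t * s ^ pq.1 + divDiff pq.2 t s * t ^ pq.1) =
      -(algebraMap k R (bern k n) * (s + t) ^ n) := by
  have hb : ∀ n, algebraMap ℚ R (bernoulli n / n.factorial) = algebraMap k R (bern k n) :=
    fun n => DFunLike.congr_fun (Subsingleton.elim (algebraMap ℚ R)
      ((algebraMap k R).comp (algebraMap ℚ k))) _
  have H := congrArg (PowerSeries.coeff (n + 1))
    (bernoulliPowerSeries_rescale_identity hs ht hst)
  refine mul_left_cancel₀ (mul_ne_zero hs ht) ?_
  simp only [map_add, map_neg, PowerSeries.coeff_succ_X_mul, PowerSeries.coeff_C_mul] at H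
  simp only [PowerSeries.coeff_mul, map_sub, PowerSeries.coeff_rescale, bernoulliPowerSeries,
    PowerSeries.coeff_mk, hb] at H
  rw [Finset.mul_sum, Finset.mul_sum, ← Finset.sum_add_distrib] at H
  rw [mul_neg, mul_comm (algebraMap k R _), ← H, Finset.mul_sum]
  refine Finset.sum_congr rfl fun pq _ => ?_
  rw [map_mul]
  have h1 := divDiff_mul pq.2 s t
  have h2 := divDiff_mul pq.2 t s
  rw [add_comm t s] at h2
  linear_combination
    algebraMap k R (bern k pq.1) * algebraMap k R (bern k pq.2) * t * s ^ pq.1 * h1 +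
    algebraMap k R (bern k pq.1) * algebraMap k R (bern k pq.2) * s * t ^ pq.1 * h2

theorem bern_identity {A : Type*} [Ring A] [Algebra k A] {a b : A} (hab : Commute a b) (n : ℕ) :
    ∑ pq ∈ Finset.HasAntidiagonal.antidiagonal (n + 1), (bern k pq.1 * bern k pq.2) •
      (divDiff pq.2 a b * a ^ pq.1 + divDiff pq.2 b a * b ^ pq.1) =
      -(bern k n • (a + b) ^ n) := by
  have comm : ∀ p : Polynomial k, Commute (Polynomial.aeval a p) b := by
    intro p
    induction p using Polynomial.induction_on' with
    | add p q hp hq => rw [map_add]; exact hp.add_left hq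
    | monomial n c =>
      rw [Polynomial.aeval_monomial]
      exact (Algebra.commute_algebraMap_left c b).mul_left (hab.pow_left n)
  -- The identity is polynomial, so it is proved for two independent variables, where `s`, `t` and
  -- `s + t` are nonzero, and then specialised to the commuting pair `a`, `b`.
  let φ : Polynomial (Polynomial k) →+* A :=
    Polynomial.eval₂RingHom' (Polynomial.aeval a : Polynomial k →ₐ[k] A).toRingHom b comm
  have hφ : ∀ c : k, φ (algebraMap k _ c) = algebraMap k A c := by
    intro c
    simp [φ, Polynomial.algebraMap_apply]
  have h1 : φ (Polynomial.C Polynomial.X) = a := by simp [φ]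
  have h2 : φ Polynomial.X = b := by simp [φ]
  have H := congrArg φ (bern_identity_domain (k := k) (R := Polynomial (Polynomial k))
    (s := Polynomial.C Polynomial.X) (t := Polynomial.X) (by simp) (by simp) (by
      intro h0
      have := congrArg (Polynomial.coeff · 1) h0
      simp at this) n)
  simpa only [map_sum, map_mul, map_add, map_neg, map_pow, hφ, h1, h2, divDiff,
    Algebra.smul_def] using H

end Bernoulli

/-! ### Constant coefficient differential operators with values in endomorphisms -/

section Symbol

variable {k L ι V W : Type*} [Field k] [AddCommGroup L] [Module k L]
  [AddCommGroup V] [Module k V] [AddCommGroup W] [Module k W] (b : Module.Basis ι k L)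

/-- The partial derivative of `S(L)` along a basis vector. -/
def pderiv (i : ι) : Derivation k (Sym k L) (Sym k L) :=
  extendDer (Algebra.linearMap k (Sym k L) ∘ₗ b.coord i)

theorem pderiv_gen (i : ι) (x : L) :
    pderiv b i (gen k L x) = algebraMap k (Sym k L) (b.coord i x) := by
  simp [pderiv, extendDer_gen]

theorem pderiv_comm (i j : ι) (f : Sym k L) :
    pderiv b i (pderiv b j f) = pderiv b j (pderiv b i f) := by
  have : ⁅pderiv b i, pderiv b j⁆ = 0 := by
    apply der_ext
    intro x
    simp [Derivation.commutator_apply, pderiv_gen]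
  have := DFunLike.congr_fun this f
  rwa [Derivation.commutator_apply, Derivation.coe_zero, Pi.zero_apply, sub_eq_zero] at this

variable [Fintype ι]

/-- The operator `∑ᵢ ∂ᵢ ⊗ A(eᵢ)` on `S(L) ⊗ V`. -/
def symbolOp (A : L →ₗ[k] Module.End k V) : Module.End k (Sym k L ⊗[k] V) :=
  ∑ i, TensorProduct.map (pderiv b i : Sym k L →ₗ[k] Sym k L) (A (b i))

theorem symbolOp_tmul (A : L →ₗ[k] Module.End k V) (f : Sym k L) (v : V) :
    symbolOp b A (f ⊗ₜ v) = ∑ i, pderiv b i f ⊗ₜ A (b i) v := by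
  simp [symbolOp, LinearMap.sum_apply]

theorem symbolOp_add (A B : L →ₗ[k] Module.End k V) :
    symbolOp b (A + B) = symbolOp b A + symbolOp b B := by
  simp [symbolOp, TensorProduct.map_add_right, Finset.sum_add_distrib]

theorem symbolOp_natural {A : L →ₗ[k] Module.End k V} {B : L →ₗ[k] Module.End k W}
    {T : V →ₗ[k] W} (H : ∀ x v, T (A x v) = B x (T v)) (w : Sym k L ⊗[k] V) :
    T.lTensor (Sym k L) (symbolOp b A w) = symbolOp b B (T.lTensor (Sym k L) w) := by
  induction w with
  | zero => simp
  | add v w hv hw => simp only [map_add, hv, hw]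
  | tmul f v => simp [symbolOp_tmul, H]

theorem symbolOp_pow_natural {A : L →ₗ[k] Module.End k V} {B : L →ₗ[k] Module.End k W}
    {T : V →ₗ[k] W} (H : ∀ x v, T (A x v) = B x (T v)) (n : ℕ) (w : Sym k L ⊗[k] V) :
    T.lTensor (Sym k L) ((symbolOp b A ^ n) w) = (symbolOp b B ^ n) (T.lTensor (Sym k L) w) := by
  induction n generalizing w with
  | zero => rfl
  | succ n ih => rw [pow_succ, pow_succ, Module.End.mul_apply, Module.End.mul_apply, ih,
      symbolOp_natural b H]

theorem symbolOp_commute {A B : L →ₗ[k] Module.End k V} (H : ∀ x y, Commute (A x) (B y)) :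
    Commute (symbolOp b A) (symbolOp b B) := by
  refine Commute.sum_left _ _ _ fun i _ => Commute.sum_right _ _ _ fun j _ => ?_
  apply TensorProduct.ext'
  intro f v
  have := LinearMap.congr_fun (H (b i) (b j)) v
  simp only [Module.End.mul_apply] at this
  simp only [Module.End.mul_apply, TensorProduct.map_tmul, Derivation.coeFn_coe, this]
  rw [pderiv_comm]

/-- The commutator of `∑ ∂ᵢ ⊗ A(eᵢ)` with multiplication by `x` is `∑ xᵢ A(eᵢ) = A x`, since `∂ᵢ x`
is the coordinate `xᵢ`. -/
theorem symbolOp_gen_smul (A : L →ₗ[k] Module.End k V) (x : L) (w : Sym k L ⊗[k] V) :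
    symbolOp b A (gen k L x • w) =
      (A x).lTensor (Sym k L) w + gen k L x • symbolOp b A w := by
  induction w with
  | zero => simp
  | add v w hv hw => rw [smul_add, map_add, hv, hw, map_add, map_add, smul_add]; abel
  | tmul f v =>
    rw [TensorProduct.smul_tmul', symbolOp_tmul, symbolOp_tmul, Finset.smul_sum]
    simp only [smul_eq_mul, Derivation.leibniz, pderiv_gen, TensorProduct.add_tmul,
      Finset.sum_add_distrib, TensorProduct.smul_tmul']
    rw [add_comm]
    congr 1
    conv_rhs => rw [← b.sum_repr x]
    rw [LinearMap.lTensor_tmul, map_sum, LinearMap.sum_apply, TensorProduct.tmul_sum]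
    refine Finset.sum_congr rfl fun i _ => ?_
    rw [map_smul, LinearMap.smul_apply, mul_comm, ← Algebra.smul_def, TensorProduct.smul_tmul]
    rfl

/-- The Leibniz rule for the commutator of a power. `A x` need not commute with the operator, so its
position in each summand is kept; this sum is the origin of `divDiff`. -/
theorem symbolOp_pow_gen_smul (A : L →ₗ[k] Module.End k V) (x : L) (n : ℕ)
    (w : Sym k L ⊗[k] V) :
    (symbolOp b A ^ n) (gen k L x • w) = gen k L x • (symbolOp b A ^ n) w +
      ∑ i ∈ Finset.range n, (symbolOp b A ^ i)
        ((A x).lTensor (Sym k L) ((symbolOp b A ^ (n - 1 - i)) w)) := by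
  induction n with
  | zero => simp
  | succ n ih =>
    have h : ∑ i ∈ Finset.range (n + 1), (symbolOp b A ^ i)
        ((A x).lTensor (Sym k L) ((symbolOp b A ^ (n + 1 - 1 - i)) w)) =
        symbolOp b A (∑ i ∈ Finset.range n, (symbolOp b A ^ i)
          ((A x).lTensor (Sym k L) ((symbolOp b A ^ (n - 1 - i)) w))) +
        (A x).lTensor (Sym k L) ((symbolOp b A ^ n) w) := by
      rw [Finset.sum_range_succ', map_sum]
      congr 1
      refine Finset.sum_congr rfl fun i _ => ?_
      rw [pow_succ', Module.End.mul_apply, Nat.add_sub_cancel, Nat.sub_sub, Nat.add_comm 1 i]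
    rw [h, pow_succ', Module.End.mul_apply, ih, map_add, symbolOp_gen_smul, Module.End.mul_apply]
    abel

end Symbol

/-! ### The symmetrized left multiplication operators -/

section Gutt

variable {k L ι : Type*} [Field k] [LieRing L] [LieAlgebra k L] [Fintype ι]
  (b : Module.Basis ι k L)

variable (k L) in
/-- The adjoint representation as a linear map. -/
def adLin : L →ₗ[k] Module.End k L := LieAlgebra.ad k L

theorem adLin_apply (x y : L) : adLin k L x y = ⁅x, y⁆ := rfl

variable (k L) in
/-- The adjoint representation on the first factor of `L ⊗ L`. -/
def adLeft : L →ₗ[k] Module.End k (L ⊗[k] L) := LinearMap.rTensorHom L ∘ₗ adLin k L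

variable (k L) in
/-- The adjoint representation on the second factor of `L ⊗ L`. -/
def adRight : L →ₗ[k] Module.End k (L ⊗[k] L) := LinearMap.lTensorHom L ∘ₗ adLin k L

theorem adLeft_tmul (x y z : L) : adLeft k L x (y ⊗ₜ z) = ⁅x, y⁆ ⊗ₜ z := rfl

theorem adRight_tmul (x y z : L) : adRight k L x (y ⊗ₜ z) = y ⊗ₜ ⁅x, z⁆ := rfl

variable (k L) in
/-- The multiplication map `S(L) ⊗ L → S(L)`. -/
def symMul : Sym k L ⊗[k] L →ₗ[Sym k L] Sym k L := (gen k L).liftBaseChange (Sym k L)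

variable (k L) in
/-- The multiplication map `S(L) ⊗ L ⊗ L → S(L)`. -/
def symMul₂ : Sym k L ⊗[k] (L ⊗[k] L) →ₗ[Sym k L] Sym k L :=
  (LinearMap.mul' k (Sym k L) ∘ₗ TensorProduct.map (gen k L) (gen k L)).liftBaseChange (Sym k L)

variable (k L) in
/-- The Lie bracket `L ⊗ L → L`. -/
def lieMap : L ⊗[k] L →ₗ[k] L := TensorProduct.lift (adLin k L)

theorem lieMap_tmul (x y : L) : lieMap k L (x ⊗ₜ y) = ⁅x, y⁆ := rfl

/-- By the Jacobi identity the bracket `L ⊗ L → L` intertwines the diagonal adjoint action with the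
adjoint action. -/
theorem lieMap_symbolOp_pow (n : ℕ) (w : Sym k L ⊗[k] (L ⊗[k] L)) :
    (lieMap k L).lTensor (Sym k L) (((symbolOp b (adLeft k L) + symbolOp b (adRight k L)) ^ n) w) =
      (symbolOp b (adLin k L) ^ n) ((lieMap k L).lTensor (Sym k L) w) := by
  rw [← symbolOp_add]
  refine symbolOp_pow_natural b (fun y v => ?_) n w
  induction v with
  | zero => simp
  | add v w hv hw => simp only [map_add, hv, hw]
  | tmul v w =>
    rw [LinearMap.add_apply, LinearMap.add_apply, map_add, adLeft_tmul, adRight_tmul,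
      lieMap_tmul, lieMap_tmul, lieMap_tmul, adLin_apply]
    exact (leibniz_lie y v w).symm

/-- The coefficients of the left multiplication by `x` in the Gutt star product. -/
def guttCoeff (n : ℕ) : L →ₗ[k] Module.End k (Sym k L) :=
  ((TensorProduct.mk k (Sym k L) L).compr₂
    ((symMul k L).restrictScalars k ∘ₗ (symbolOp b (adLin k L) ^ n))).flip

theorem guttCoeff_apply (n : ℕ) (x : L) (f : Sym k L) :
    guttCoeff b n x f = symMul k L ((symbolOp b (adLin k L) ^ n) (f ⊗ₜ x)) := rfl

/-- Let `w = g ⊗ z`. Moving `z` out through the `n`-th power gives one term where `z` stays a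
factor, and terms where `ad z` is inserted once. An insertion is the bracket of the two slots:
operators applied before it act on the slot of `x`, those applied after it act diagonally, whence
`divDiff`. -/
theorem guttCoeff_symMul (n : ℕ) (x : L) (w : Sym k L ⊗[k] L) :
    guttCoeff b n x (symMul k L w) =
      symMul₂ k L ((symbolOp b (adRight k L) ^ n)
        (((TensorProduct.mk k L L).flip x).lTensor (Sym k L) w)) +
      symMul k L ((lieMap k L).lTensor (Sym k L)
        (divDiff n (symbolOp b (adLeft k L)) (symbolOp b (adRight k L))
          (((TensorProduct.mk k L L).flip x).lTensor (Sym k L) w))) := by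
  induction w with
  | zero => simp
  | add v w hv hw => simp only [map_add, hv, hw]; abel
  | tmul g z =>
    have e1 : ((TensorProduct.mk k L L).flip x).lTensor (Sym k L) (g ⊗ₜ z) =
        (TensorProduct.mk k L L z).lTensor (Sym k L) (g ⊗ₜ x) := rfl
    have e2 : symMul k L (g ⊗ₜ z) ⊗ₜ[k] x = gen k L z • (g ⊗ₜ[k] x) := by
      simp [symMul, TensorProduct.smul_tmul', mul_comm]
    have nat : ∀ n w, (symbolOp b (adRight k L) ^ n)
        ((TensorProduct.mk k L L z).lTensor (Sym k L) w) =
        (TensorProduct.mk k L L z).lTensor (Sym k L) ((symbolOp b (adLin k L) ^ n) w) :=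
      fun n w => (symbolOp_pow_natural b (fun _ _ => rfl) n w).symm
    have mul₂ : ∀ w, symMul₂ k L ((TensorProduct.mk k L L z).lTensor (Sym k L) w) =
        gen k L z * symMul k L w := by
      intro w
      induction w with
      | zero => simp
      | add v w hv hw => simp only [map_add, hv, hw, mul_add]
      | tmul f y => simp [symMul, symMul₂]; ring
    have br : ∀ w, (lieMap k L).lTensor (Sym k L)
        ((TensorProduct.mk k L L z).lTensor (Sym k L) w) =
          (adLin k L z).lTensor (Sym k L) w := by
      intro w
      rw [← LinearMap.comp_apply, ← LinearMap.lTensor_comp]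
      rfl
    rw [e1, nat, mul₂, guttCoeff_apply, e2, symbolOp_pow_gen_smul, map_add, map_smul, smul_eq_mul]
    congr 1
    rw [divDiff, LinearMap.sum_apply, map_sum, map_sum, map_sum]
    refine Finset.sum_congr rfl fun i _ => ?_
    rw [Module.End.mul_apply, lieMap_symbolOp_pow, nat, br]

theorem guttCoeff_guttCoeff (p q : ℕ) (x y : L) (f : Sym k L) :
    guttCoeff b p x (guttCoeff b q y f) =
      symMul₂ k L ((symbolOp b (adRight k L) ^ p * symbolOp b (adLeft k L) ^ q)
        (f ⊗ₜ (y ⊗ₜ x))) +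
      symMul k L ((lieMap k L).lTensor (Sym k L)
        ((divDiff p (symbolOp b (adLeft k L)) (symbolOp b (adRight k L)) *
          symbolOp b (adLeft k L) ^ q) (f ⊗ₜ (y ⊗ₜ x)))) := by
  rw [guttCoeff_apply b q, guttCoeff_symMul,
    symbolOp_pow_natural b (B := adLeft k L) (fun _ _ => rfl)]
  rfl

/-- Obtained from `guttCoeff_guttCoeff` by the flip of `L ⊗ L`, under which the product is symmetric
and the bracket antisymmetric. Both compositions are thus evaluated on the same tensor `f ⊗ (y ⊗ x)`
and can be subtracted. -/
theorem guttCoeff_guttCoeff_swap (p q : ℕ) (x y : L) (f : Sym k L) :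
    guttCoeff b p y (guttCoeff b q x f) =
      symMul₂ k L ((symbolOp b (adLeft k L) ^ p * symbolOp b (adRight k L) ^ q)
        (f ⊗ₜ (y ⊗ₜ x))) -
      symMul k L ((lieMap k L).lTensor (Sym k L)
        ((divDiff p (symbolOp b (adRight k L)) (symbolOp b (adLeft k L)) *
          symbolOp b (adRight k L) ^ q) (f ⊗ₜ (y ⊗ₜ x)))) := by
  let τ := (TensorProduct.comm k L L).toLinearMap.lTensor (Sym k L)
  have ext₃ : ∀ {N : Type _} [AddCommGroup N] [Module k N]
      {φ ψ : Sym k L ⊗[k] (L ⊗[k] L) →ₗ[k] N}, (∀ f x y, φ (f ⊗ₜ (x ⊗ₜ y)) = ψ (f ⊗ₜ (x ⊗ₜ y))) →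
      φ = ψ := by
    intro N _ _ φ ψ H
    apply TensorProduct.ext
    ext f : 1
    apply TensorProduct.ext'
    exact H f
  have t1 : τ ∘ₗ symbolOp b (adLeft k L) = symbolOp b (adRight k L) ∘ₗ τ :=
    ext₃ fun f x y => by
      simp [τ, symbolOp_tmul, adLeft_tmul, adRight_tmul]
  have t2 : τ ∘ₗ symbolOp b (adRight k L) = symbolOp b (adLeft k L) ∘ₗ τ :=
    ext₃ fun f x y => by
      simp [τ, symbolOp_tmul, adLeft_tmul, adRight_tmul]
  have t3 : (symMul₂ k L).restrictScalars k ∘ₗ τ = (symMul₂ k L).restrictScalars k :=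
    ext₃ fun f x y => by
      simp [τ, symMul₂, mul_comm]
  have t4 : (lieMap k L).lTensor (Sym k L) ∘ₗ τ = -(lieMap k L).lTensor (Sym k L) :=
    ext₃ fun f x y => by
      simp only [τ, LinearMap.comp_apply, LinearMap.lTensor_tmul, LinearEquiv.coe_coe,
        TensorProduct.comm_tmul, lieMap_tmul, LinearMap.neg_apply]
      rw [← lie_skew, TensorProduct.tmul_neg]
  have tpow : ∀ {A B : Module.End k (Sym k L ⊗[k] (L ⊗[k] L))}, τ ∘ₗ A = B ∘ₗ τ →
      ∀ n w, (B ^ n) (τ w) = τ ((A ^ n) w) := by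
    intro A B hAB n w
    induction n generalizing w with
    | zero => rfl
    | succ n ih =>
      rw [pow_succ, pow_succ, Module.End.mul_apply, Module.End.mul_apply, ← ih]
      exact congrArg _ (LinearMap.congr_fun hAB w).symm
  have tw : f ⊗ₜ[k] (x ⊗ₜ[k] y) = τ (f ⊗ₜ (y ⊗ₜ x)) := rfl
  have tdiv : ∀ w, divDiff p (symbolOp b (adLeft k L)) (symbolOp b (adRight k L)) (τ w) =
      τ (divDiff p (symbolOp b (adRight k L)) (symbolOp b (adLeft k L)) w) := by
    intro w
    simp only [divDiff, LinearMap.sum_apply, map_sum, Module.End.mul_apply]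
    refine Finset.sum_congr rfl fun i _ => ?_
    rw [tpow t1, tpow (A := symbolOp b (adRight k L) + symbolOp b (adLeft k L))]
    rw [LinearMap.comp_add, LinearMap.add_comp, t1, t2, add_comm]
  have h3 := fun w => LinearMap.congr_fun t3 w
  have h4 := fun w => LinearMap.congr_fun t4 w
  simp only [LinearMap.comp_apply, LinearMap.restrictScalars_apply, LinearMap.neg_apply] at h3 h4
  rw [guttCoeff_guttCoeff, tw]
  simp only [Module.End.mul_apply]
  rw [tpow t2, tpow t1, h3, tdiv, h4, map_neg, sub_eq_add_neg]

theorem guttCoeff_zero (x : L) (f : Sym k L) : guttCoeff b 0 x f = gen k L x * f := by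
  rw [guttCoeff_apply, pow_zero, Module.End.one_apply]
  simp [symMul, mul_comm]

theorem guttCoeff_one_gen (x y : L) : guttCoeff b 1 x (gen k L y) = gen k L ⁅y, x⁆ := by
  have h : gen k L y ⊗ₜ[k] x = gen k L y • (1 ⊗ₜ[k] x) := by
    rw [TensorProduct.smul_tmul', smul_eq_mul, mul_one]
  have h0 : symbolOp b (adLin k L) ((1 : Sym k L) ⊗ₜ[k] x) = 0 := by simp [symbolOp_tmul]
  rw [guttCoeff_apply, pow_one, h, symbolOp_gen_smul, h0]
  simp [symMul, adLin_apply]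

/-- Each application of `symbolOp` differentiates the first factor once, and a generator has degree
one. Hence `x ⋆ y` stops at order `ħ`. -/
theorem guttCoeff_gen_eq_zero (n : ℕ) (x y : L) : guttCoeff b (n + 2) x (gen k L y) = 0 := by
  have h : gen k L y ⊗ₜ[k] x = gen k L y • (1 ⊗ₜ[k] x) := by
    rw [TensorProduct.smul_tmul', smul_eq_mul, mul_one]
  have h0 : ∀ z, symbolOp b (adLin k L) ((1 : Sym k L) ⊗ₜ[k] z) = 0 := by simp [symbolOp_tmul]
  rw [guttCoeff_apply, pow_add, pow_two, Module.End.mul_apply, Module.End.mul_apply, h,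
    symbolOp_gen_smul, h0, smul_zero, add_zero, LinearMap.lTensor_tmul, h0, map_zero, map_zero]

theorem guttCoeff_one_eq_zero (n : ℕ) (x : L) : guttCoeff b (n + 1) x 1 = 0 := by
  have h0 : ∀ z, symbolOp b (adLin k L) ((1 : Sym k L) ⊗ₜ[k] z) = 0 := by simp [symbolOp_tmul]
  rw [guttCoeff_apply, pow_succ, Module.End.mul_apply, h0, map_zero, map_zero]

end Gutt

/-! ### Operator series in `ħ` and first-order commutators -/

section OpSeries

open Finset.HasAntidiagonal

variable {k L : Type*} [Field k] [LieRing L] [LieAlgebra k L]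

/-- The operator `∑ ħⁿ Dₙ` on `S(L)[[ħ]]`. -/
def opSeries (D : ℕ → Module.End k (Sym k L)) : Module.End (k⟦X⟧) (SymH k L) where
  toFun f := PowerSeries.mk fun n =>
    ∑ pq ∈ antidiagonal n, D pq.1 (PowerSeries.coeff pq.2 f)
  map_add' f g := by
    ext n
    simp [Finset.sum_add_distrib]
  map_smul' r f := by
    ext n
    have hs : ∀ (g : SymH k L) m, PowerSeries.coeff m (r • g) =
        ∑ pq ∈ antidiagonal m, PowerSeries.coeff pq.1 r • PowerSeries.coeff pq.2 g := by
      intro g m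
      rw [smul_eq_map_mul, PowerSeries.coeff_mul]
      simp only [PowerSeries.coeff_map, Algebra.smul_def]
    rw [RingHom.id_apply, hs]
    simp only [PowerSeries.coeff_mk, hs, map_sum, map_smul, Finset.smul_sum]
    rw [Finset.sum_sigma', Finset.sum_sigma']
    -- Both sides sum over triples of degrees, for the operator, the scalar and the series; the
    -- involution exchanges the first two.
    refine Finset.sum_bij' (fun a _ => ⟨(a.2.1, a.1.1 + a.2.2), (a.1.1, a.2.2)⟩)
      (fun a _ => ⟨(a.2.1, a.1.1 + a.2.2), (a.1.1, a.2.2)⟩) ?_ ?_ ?_ ?_ (fun _ _ => rfl)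
    all_goals
      simp only [Finset.mem_sigma, mem_antidiagonal, and_true]
    · rintro ⟨⟨a, b⟩, c, d⟩ ⟨h1, h2⟩
      simp only at *
      omega
    · rintro ⟨⟨a, b⟩, c, d⟩ ⟨h1, h2⟩
      simp only at *
      omega
    · rintro ⟨⟨a, b⟩, c, d⟩ ⟨h1, h2⟩
      simp only at *
      rw [h2]
    · rintro ⟨⟨a, b⟩, c, d⟩ ⟨h1, h2⟩
      simp only at *
      rw [h2]

theorem coeff_opSeries (D : ℕ → Module.End k (Sym k L)) (f : SymH k L) (n : ℕ) :
    PowerSeries.coeff n (opSeries D f) =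
      ∑ pq ∈ antidiagonal n, D pq.1 (PowerSeries.coeff pq.2 f) := by
  simp [opSeries]

theorem coeff_opSeries_const (D : ℕ → Module.End k (Sym k L)) (f : Sym k L) (n : ℕ) :
    PowerSeries.coeff n (opSeries D (const k L f)) = D n f := by
  rw [coeff_opSeries, Finset.sum_eq_single (n, 0)]
  · rw [coeff_zero_const]
  · rintro ⟨p, q⟩ hpq hne
    have hq : q ≠ 0 := by
      rintro rfl
      rw [mem_antidiagonal] at hpq
      exact hne (by simp_all)
    simp [const, PowerSeries.coeff_C, hq]
  · simp

/-- No continuity is assumed: `k⟦X⟧`-linearity lets one split off constant terms repeatedly, so the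
difference of the values is divisible by every power of `ħ`. -/
theorem symH_hom_ext {φ ψ : Module.End (k⟦X⟧) (SymH k L)}
    (H : ∀ f, φ (const k L f) = ψ (const k L f)) : φ = ψ := by
  ext1 f
  rw [← sub_eq_zero]
  refine (isAdicComplete_span_iff.1 isAdicComplete_symH).1 _ fun n => ?_
  induction n generalizing f with
  | zero => exact ⟨φ f - ψ f, by simp⟩
  | succ n ih =>
    obtain ⟨f', hf'⟩ := eq_const_add f
    obtain ⟨y, hy⟩ := ih f'
    refine ⟨y, ?_⟩
    rw [hf', map_add, map_add, H, map_smul, map_smul, add_sub_add_left_eq_sub, ← smul_sub, hy,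
      smul_smul, pow_succ']

/-- A bilinear unital product with the right classical limit and the right commutators of
generators has the right semiclassical limit. -/
theorem semiclassical_limit_of_gen_comm (mul : SymH k L →ₗ[k⟦X⟧] SymH k L →ₗ[k⟦X⟧] SymH k L)
    (one_mul : ∀ a, mul 1 a = a) (mul_one : ∀ a, mul a 1 = a)
    (assoc : ∀ a b c, mul (mul a b) c = mul a (mul b c))
    (classical_limit : ∀ f h, PowerSeries.coeff 0 (mul f h) =
      PowerSeries.coeff 0 f * PowerSeries.coeff 0 h)
    (gen_comm : ∀ x y : L,
      mul (const k L (gen k L x)) (const k L (gen k L y)) -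
        mul (const k L (gen k L y)) (const k L (gen k L x)) =
          hbar k • const k L (gen k L ⁅x, y⁆)) (f h : Sym k L) :
    PowerSeries.coeff 1 (mul (const k L f) (const k L h) - mul (const k L h) (const k L f)) =
      poisson k L f h := by
  have div : ∀ f h, ∃ c, mul f h - mul h f = hbar k • c := by
    intro f h
    obtain ⟨c, hc⟩ := eq_const_add (mul f h - mul h f)
    refine ⟨c, ?_⟩
    rw [hc, map_sub, classical_limit, classical_limit, mul_comm, sub_self, map_zero, zero_add]
  -- The first-order commutator is a derivation: `f ⋆ f'` and `f f'` differ by `ħ r`, and the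
  -- commutator of `ħ r` with `H` is divisible by `ħ ^ 2`, so it is invisible at order one.
  have leib : ∀ (f f' : Sym k L) (H : SymH k L),
      PowerSeries.coeff 1 (mul (const k L (f * f')) H - mul H (const k L (f * f'))) =
        f * PowerSeries.coeff 1 (mul (const k L f') H - mul H (const k L f')) +
        f' * PowerSeries.coeff 1 (mul (const k L f) H - mul H (const k L f)) := by
    intro f f' H
    obtain ⟨r, hr⟩ := eq_const_add (mul (const k L f) (const k L f'))
    rw [classical_limit, coeff_zero_const, coeff_zero_const] at hr
    obtain ⟨c, hc⟩ := div (const k L f') H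
    obtain ⟨d, hd⟩ := div (const k L f) H
    obtain ⟨e, he⟩ := div r H
    have : mul (const k L (f * f')) H - mul H (const k L (f * f')) =
        hbar k • (mul (const k L f) c + mul d (const k L f') - hbar k • e) := by
      rw [smul_sub, smul_add, ← map_smul, ← LinearMap.smul_apply, ← map_smul, ← hc, ← hd, ← he,
        eq_sub_of_add_eq hr.symm]
      simp only [map_sub, LinearMap.sub_apply, assoc, map_smul, LinearMap.smul_apply, smul_sub]
      abel
    rw [this, hc, hd, coeff_succ_hbar_smul, coeff_succ_hbar_smul, coeff_succ_hbar_smul, map_sub,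
      map_add, classical_limit, classical_limit, coeff_zero_hbar_smul, coeff_zero_const,
      coeff_zero_const, sub_zero, mul_comm f']
  have unit : ∀ (r : k) (H : SymH k L),
      mul (const k L (algebraMap k _ r)) H - mul H (const k L (algebraMap k _ r)) = 0 := by
    intro r H
    have : const k L (algebraMap k _ r) = algebraMap k (k⟦X⟧) r • (1 : SymH k L) := by
      rw [algebraMap_smul, Algebra.algebraMap_eq_smul_one, map_smul, const_one]
    rw [this, map_smul, map_smul, LinearMap.smul_apply, one_mul, mul_one, sub_self]
  induction f using SymmetricAlgebra.induction with
  | algebraMap r => rw [unit, map_zero]; simp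
  | mul f f' hf hf' => rw [leib, hf, hf', poisson_mul_left]
  | add f f' hf hf' =>
    rw [map_add, map_add, map_add, LinearMap.add_apply, add_sub_add_comm, map_add, hf, hf',
      map_add]
    rfl
  | ι x =>
    -- The sign change moves `h` to the first argument, so that `leib` also serves the induction on
    -- `h`.
    rw [← neg_inj, ← map_neg, neg_sub]
    induction h using SymmetricAlgebra.induction with
    | algebraMap r =>
      rw [unit, Algebra.algebraMap_eq_smul_one, map_smul, map_zero, eq_comm, neg_eq_zero]
      simp [poisson, hamiltonian, extendDer_gen]
    | mul h h' hh hh' =>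
      rw [leib, hh, hh', poisson_mul_right]
      ring
    | add h h' hh hh' =>
      rw [map_add, map_add, map_add, LinearMap.add_apply, add_sub_add_comm, map_add, hh, hh',
        map_add, neg_add]
    | ι y =>
      have h1 := congrArg (PowerSeries.coeff 1) (gen_comm x y)
      rw [coeff_succ_hbar_smul, coeff_zero_const, ← poisson_gen, ← neg_sub, map_neg] at h1
      rw [← h1, neg_neg]

end OpSeries

/-! ### The commutation relation and the Gutt star product -/

section Gutt

open Finset.HasAntidiagonal

variable {k L ι : Type*} [Field k] [CharZero k] [LieRing L] [LieAlgebra k L] [Fintype ι]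
  (b : Module.Basis ι k L)

theorem sum_bern_smul_swap {N : Type*} [AddCommGroup N] [Module k N] (n : ℕ) (F : ℕ → ℕ → N) :
    ∑ pq ∈ antidiagonal n, (bern k pq.1 * bern k pq.2) • F pq.1 pq.2 =
      ∑ pq ∈ antidiagonal n, (bern k pq.1 * bern k pq.2) • F pq.2 pq.1 := by
  rw [← Finset.Nat.sum_antidiagonal_swap]
  exact Finset.sum_congr rfl fun pq _ => by rw [Prod.fst_swap, Prod.snd_swap, mul_comm]

theorem sum_bern_guttCoeff_comm (n : ℕ) (x y : L) (f : Sym k L) :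
    ∑ pq ∈ antidiagonal n, (bern k pq.1 * bern k pq.2) •
      (guttCoeff b pq.1 x (guttCoeff b pq.2 y f) - guttCoeff b pq.1 y (guttCoeff b pq.2 x f)) =
    symMul k L ((lieMap k L).lTensor (Sym k L)
      ((∑ pq ∈ antidiagonal n, (bern k pq.1 * bern k pq.2) •
        (divDiff pq.2 (symbolOp b (adLeft k L)) (symbolOp b (adRight k L)) *
            symbolOp b (adLeft k L) ^ pq.1 +
          divDiff pq.2 (symbolOp b (adRight k L)) (symbolOp b (adLeft k L)) *
            symbolOp b (adRight k L) ^ pq.1)) (f ⊗ₜ (y ⊗ₜ x)))) := by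
  have hc : Commute (symbolOp b (adLeft k L)) (symbolOp b (adRight k L)) := by
    refine symbolOp_commute b fun u v => ?_
    apply TensorProduct.ext'
    intro z w
    rfl
  -- The terms without a bracket cancel in the sum: the two slot operators commute and the weights
  -- are symmetric in `p` and `q`.
  have h0 : ∑ pq ∈ antidiagonal n, (bern k pq.1 * bern k pq.2) •
      (symMul₂ k L ((symbolOp b (adRight k L) ^ pq.1 * symbolOp b (adLeft k L) ^ pq.2)
        (f ⊗ₜ (y ⊗ₜ x))) -
      symMul₂ k L ((symbolOp b (adLeft k L) ^ pq.1 * symbolOp b (adRight k L) ^ pq.2)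
        (f ⊗ₜ (y ⊗ₜ x)))) = 0 := by
    simp only [smul_sub, Finset.sum_sub_distrib]
    rw [sub_eq_zero, sum_bern_smul_swap n fun p q => symMul₂ k L
      ((symbolOp b (adRight k L) ^ p * symbolOp b (adLeft k L) ^ q) (f ⊗ₜ (y ⊗ₜ x)))]
    simp only [(hc.symm.pow_pow _ _).eq]
  rw [← sum_bern_smul_swap n fun p q =>
      divDiff p (symbolOp b (adLeft k L)) (symbolOp b (adRight k L)) *
            symbolOp b (adLeft k L) ^ q +
          divDiff p (symbolOp b (adRight k L)) (symbolOp b (adLeft k L)) *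
            symbolOp b (adRight k L) ^ q]
  rw [← sub_zero (∑ pq ∈ antidiagonal n, _), ← h0, ← Finset.sum_sub_distrib, LinearMap.sum_apply,
    map_sum, map_sum]
  refine Finset.sum_congr rfl fun pq _ => ?_
  rw [LinearMap.smul_apply, map_smul, ← LinearMap.restrictScalars_apply k (symMul k L), map_smul,
    ← smul_sub, guttCoeff_guttCoeff, guttCoeff_guttCoeff_swap, LinearMap.add_apply, map_add,
    map_add]
  simp only [LinearMap.restrictScalars_apply]
  congr 1
  abel

theorem sum_bern_guttCoeff_comm_zero (x y : L) (f : Sym k L) :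
    ∑ pq ∈ antidiagonal 0, (bern k pq.1 * bern k pq.2) •
      (guttCoeff b pq.1 x (guttCoeff b pq.2 y f) - guttCoeff b pq.1 y (guttCoeff b pq.2 x f)) =
    0 := by
  rw [sum_bern_guttCoeff_comm]
  simp [divDiff]

/-- `bern_identity` turns the `divDiff` sum into the `n`-th power of the diagonal operator, which
passes through the bracket; its minus sign is absorbed by `[y,x] = -[x,y]`. The drop from `n + 1` to
`n` is the factor `ħ` in `gutt_comm`. -/
theorem sum_bern_guttCoeff_comm_succ (n : ℕ) (x y : L) (f : Sym k L) :
    ∑ pq ∈ antidiagonal (n + 1), (bern k pq.1 * bern k pq.2) •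
      (guttCoeff b pq.1 x (guttCoeff b pq.2 y f) - guttCoeff b pq.1 y (guttCoeff b pq.2 x f)) =
    bern k n • guttCoeff b n ⁅x, y⁆ f := by
  have hc : Commute (symbolOp b (adLeft k L)) (symbolOp b (adRight k L)) := by
    refine symbolOp_commute b fun u v => ?_
    apply TensorProduct.ext'
    intro z w
    rfl
  rw [sum_bern_guttCoeff_comm, bern_identity hc, LinearMap.neg_apply, LinearMap.smul_apply,
    map_neg, map_smul, lieMap_symbolOp_pow, LinearMap.lTensor_tmul, lieMap_tmul, ← lie_skew,
    TensorProduct.tmul_neg, map_neg, map_neg, smul_neg, map_neg, neg_neg, guttCoeff_apply,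
    ← LinearMap.restrictScalars_apply k (symMul k L), map_smul, LinearMap.restrictScalars_apply]

/-- The left multiplication by `x` in the Gutt star product. -/
def gutt : L →ₗ[k] Module.End (k⟦X⟧) (SymH k L) where
  toFun x := opSeries fun n => bern k n • guttCoeff b n x
  map_add' x y := symH_hom_ext fun f => by
    ext n
    simp [coeff_opSeries_const]
  map_smul' c x := symH_hom_ext fun f => by
    ext n
    rw [RingHom.id_apply, LinearMap.smul_apply, PowerSeries.coeff_smul, coeff_opSeries_const,
      coeff_opSeries_const, map_smul, smul_comm]
    rfl

theorem coeff_gutt_const (x : L) (f : Sym k L) (n : ℕ) :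
    PowerSeries.coeff n (gutt b x (const k L f)) = bern k n • guttCoeff b n x f :=
  coeff_opSeries_const _ _ _

theorem coeff_gutt (x : L) (f : SymH k L) (n : ℕ) :
    PowerSeries.coeff n (gutt b x f) =
      ∑ pq ∈ antidiagonal n, bern k pq.1 • guttCoeff b pq.1 x (PowerSeries.coeff pq.2 f) :=
  coeff_opSeries _ _ _

theorem gutt_comm (x y : L) :
    gutt b x * gutt b y - gutt b y * gutt b x = hbar k • gutt b ⁅x, y⁆ := by
  refine symH_hom_ext fun f => ?_
  ext n
  have key : PowerSeries.coeff n ((gutt b x * gutt b y - gutt b y * gutt b x) (const k L f)) =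
      ∑ pq ∈ antidiagonal n, (bern k pq.1 * bern k pq.2) •
        (guttCoeff b pq.1 x (guttCoeff b pq.2 y f) -
          guttCoeff b pq.1 y (guttCoeff b pq.2 x f)) := by
    rw [LinearMap.sub_apply, Module.End.mul_apply, Module.End.mul_apply, map_sub, coeff_gutt,
      coeff_gutt, ← Finset.sum_sub_distrib]
    refine Finset.sum_congr rfl fun pq _ => ?_
    rw [coeff_gutt_const, coeff_gutt_const, map_smul, map_smul, smul_smul, smul_smul, smul_sub]
  rw [key, LinearMap.smul_apply]
  cases n with
  | zero => rw [sum_bern_guttCoeff_comm_zero, coeff_zero_hbar_smul]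
  | succ n => rw [sum_bern_guttCoeff_comm_succ, coeff_succ_hbar_smul, coeff_gutt_const]

theorem coeff_zero_gutt (x : L) (f : SymH k L) :
    PowerSeries.coeff 0 (gutt b x f) = gen k L x * PowerSeries.coeff 0 f := by
  rw [coeff_gutt, Finset.Nat.antidiagonal_zero, Finset.sum_singleton, guttCoeff_zero, bern_zero,
    one_smul]

theorem gutt_one (x : L) : gutt b x 1 = const k L (gen k L x) := by
  rw [← const_one]
  ext n
  rw [coeff_gutt_const]
  cases n with
  | zero => rw [guttCoeff_zero, bern_zero, one_smul, mul_one, coeff_zero_const]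
  | succ n => rw [guttCoeff_one_eq_zero, smul_zero]; simp [const]

theorem gutt_gen (x y : L) :
    gutt b x (const k L (gen k L y)) = const k L (gen k L x * gen k L y) +
      hbar k • const k L ((2 : k)⁻¹ • gen k L ⁅x, y⁆) := by
  ext n
  rw [coeff_gutt_const, map_add]
  match n with
  | 0 => rw [guttCoeff_zero, bern_zero, one_smul, coeff_zero_hbar_smul, coeff_zero_const, add_zero]
  | 1 =>
    rw [guttCoeff_one_gen, bern_one, coeff_succ_hbar_smul, coeff_zero_const, ← lie_skew, map_neg,
      neg_smul, smul_neg, neg_neg]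
    simp [const]
  | n + 2 =>
    rw [guttCoeff_gen_eq_zero, smul_zero, coeff_succ_hbar_smul]
    simp [const]

/-- The action of `U_ħ(L)` on `S(L)[[ħ]]` by left multiplications of the Gutt star product. -/
def guttAct : Uh k L →ₐ[k⟦X⟧] Module.End (k⟦X⟧) (SymH k L) := ulift (gutt b) (gutt_comm b)

/-- The orbit map `u ↦ u · 1` of the action of `U_ħ(L)` on `S(L)[[ħ]]`. -/
def guttEval : Uh k L →ₗ[k⟦X⟧] SymH k L :=
  LinearMap.applyₗ (1 : SymH k L) ∘ₗ (guttAct b).toLinearMap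

theorem guttEval_apply (u : Uh k L) : guttEval b u = guttAct b u 1 := rfl

theorem guttAct_ugen (x : L) : guttAct b (ugen k L x) = gutt b x := ulift_ugen k L _ _ x

theorem guttEval_one : guttEval b 1 = 1 := by
  rw [guttEval_apply, map_one (guttAct b), Module.End.one_apply]

theorem guttEval_ugen (x : L) : guttEval b (ugen k L x) = const k L (gen k L x) := by
  rw [guttEval_apply, guttAct_ugen, gutt_one]

/-- Modulo `ħ` each generator acts by ordinary multiplication, hence so does all of `U_ħ(L)`. This
makes the constant term of the orbit map multiplicative. -/
theorem coeff_zero_guttAct (u : Uh k L) (f : SymH k L) :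
    PowerSeries.coeff 0 (guttAct b u f) =
      PowerSeries.coeff 0 (guttEval b u) * PowerSeries.coeff 0 f := by
  induction u using uh_induction generalizing f with
  | one => rw [guttEval_one, map_one (guttAct b), Module.End.one_apply, ← const_one, coeff_zero_const, one_mul]
  | gen x => rw [guttAct_ugen, coeff_zero_gutt, guttEval_ugen, coeff_zero_const]
  | add u v hu hv => rw [map_add, map_add, LinearMap.add_apply, map_add, map_add, hu, hv, add_mul]
  | smul r u hu =>
    rw [map_smul, map_smul, LinearMap.smul_apply, coeff_zero_smul, coeff_zero_smul, hu,
      smul_mul_assoc]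
  | mul u v hu hv =>
    rw [guttEval_apply, map_mul, Module.End.mul_apply, Module.End.mul_apply, hu, hv, hu (guttAct b v 1),
      ← guttEval_apply, mul_assoc]

theorem isQuantization_guttEval : IsQuantization (guttEval b) where
  coeff_one := by rw [guttEval_one, ← const_one, coeff_zero_const]
  coeff_mul u v := by
    rw [guttEval_apply, map_mul, Module.End.mul_apply, coeff_zero_guttAct, ← guttEval_apply]
  coeff_gen x := by rw [guttEval_ugen, coeff_zero_const]

/-- The Gutt star product as a bilinear map. -/
def guttMul : SymH k L →ₗ[k⟦X⟧] SymH k L →ₗ[k⟦X⟧] SymH k L :=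
  (isQuantization_guttEval b).isEquivMod.extend₂ isAdicComplete_symH
    ((LinearMap.mul (k⟦X⟧) (Uh k L)).compr₂ (guttEval b))

theorem guttMul_guttEval (u v : Uh k L) :
    guttMul b (guttEval b u) (guttEval b v) = guttEval b (u * v) :=
  (isQuantization_guttEval b).isEquivMod.extend₂_apply isAdicComplete_symH _ u v

theorem coeff_zero_guttMul (f h : SymH k L) :
    PowerSeries.coeff 0 (guttMul b f h) = PowerSeries.coeff 0 f * PowerSeries.coeff 0 h := by
  have hq := isQuantization_guttEval b
  obtain ⟨u, f', rfl⟩ := hq.isEquivMod.surj f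
  obtain ⟨v, h', rfl⟩ := hq.isEquivMod.surj h
  simp only [map_add, map_smul, LinearMap.add_apply, LinearMap.smul_apply, coeff_zero_hbar_smul,
    guttMul_guttEval, hq.coeff_mul, add_zero]

/-- The Gutt star product. -/
def guttStar : StarProduct k L :=
  -- On the image of `guttEval` the product is that of `U_ħ(L)`; the unit and associativity laws
  -- hold there and extend by uniqueness.
  have hq := (isQuantization_guttEval b).isEquivMod
  have one_mul : ∀ a, guttMul b 1 a = a := LinearMap.congr_fun
    (hq.hom_ext isAdicComplete_symH (ψ := LinearMap.id) fun u => by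
      rw [← guttEval_one b, guttMul_guttEval, _root_.one_mul, LinearMap.id_apply])
  have mul_one : ∀ a, guttMul b a 1 = a := LinearMap.congr_fun
    (hq.hom_ext isAdicComplete_symH (φ := (guttMul b).flip 1) (ψ := LinearMap.id) fun u => by
      rw [LinearMap.flip_apply, ← guttEval_one b, guttMul_guttEval, _root_.mul_one,
        LinearMap.id_apply])
  have assoc : ∀ f h l, guttMul b (guttMul b f h) l = guttMul b f (guttMul b h l) := by
    intro f h l
    exact LinearMap.congr_fun (LinearMap.congr_fun (LinearMap.congr_fun
      (hq.hom_ext₃ isAdicComplete_symH (φ := (guttMul b).compr₂ (guttMul b))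
        (ψ := (LinearMap.llcomp _ _ _ _ ∘ₗ guttMul b).compl₂ (guttMul b)) fun u v w => by
          simp [guttMul_guttEval, mul_assoc]) f) h) l
  have gen_comm : ∀ x y : L,
      guttMul b (const k L (gen k L x)) (const k L (gen k L y)) -
        guttMul b (const k L (gen k L y)) (const k L (gen k L x)) =
          hbar k • const k L (gen k L ⁅x, y⁆) := fun x y => by
    simp only [← guttEval_ugen b, guttMul_guttEval]
    rw [← map_sub, ugen_comm, map_smul]
  { mul := guttMul b
    one_mul := one_mul
    mul_one := mul_one
    assoc := assoc
    classical_limit := fun f h => by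
      rw [coeff_zero_guttMul, coeff_zero_const, coeff_zero_const]
    semiclassical_limit := semiclassical_limit_of_gen_comm _ one_mul mul_one assoc
      (coeff_zero_guttMul b) gen_comm
    gen_comm := gen_comm }

theorem guttStar_gen (x y : L) :
    (guttStar b).mul (const k L (gen k L x)) (const k L (gen k L y)) =
      const k L (gen k L x * gen k L y) + hbar k • const k L ((2 : k)⁻¹ • gen k L ⁅x, y⁆) := by
  change guttMul b _ _ = _
  rw [← gutt_gen b, ← guttEval_ugen b x, ← guttEval_ugen b y, guttMul_guttEval, guttEval_apply,
    map_mul, Module.End.mul_apply, guttAct_ugen]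
  rfl

end Gutt

/-! ### Tensoring with a finite-dimensional space -/

section TensorFinite

variable {k R : Type*} [Field k] [CommRing R] [Algebra k R] {h : R}
variable {U V G κ : Type*} [AddCommGroup U] [Module k U] [Module R U] [IsScalarTower k R U]
  [AddCommGroup V] [Module k V] [Module R V] [IsScalarTower k R V]
  [AddCommGroup G] [Module k G] (b : Module.Basis κ k G)

variable (R U) in
/-- The coordinates of an element of `U ⊗ G` with respect to a basis of `G`. -/
def tensorCoord (i : κ) : U ⊗[k] G →ₗ[R] U :=
  (TensorProduct.AlgebraTensorModule.rid k R U).toLinearMap ∘ₗ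
    TensorProduct.AlgebraTensorModule.map LinearMap.id (b.coord i)

theorem tensorCoord_tmul (i : κ) (u : U) (x : G) :
    tensorCoord R U b i (u ⊗ₜ x) = b.coord i x • u := by
  simp [tensorCoord]

theorem tensorCoord_map (j : U →ₗ[R] V) (i : κ) (t : U ⊗[k] G) :
    tensorCoord R V b i (TensorProduct.AlgebraTensorModule.map j (LinearMap.id : G →ₗ[k] G) t) =
      j (tensorCoord R U b i t) := by
  induction t with
  | zero => simp
  | add s t hs ht => simp only [map_add, hs, ht]
  | tmul u x =>
    rw [TensorProduct.AlgebraTensorModule.map_tmul, tensorCoord_tmul, tensorCoord_tmul,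
      ← algebraMap_smul R, ← algebraMap_smul R (b.coord i x) u, map_smul]
    rfl

variable [Fintype κ]

variable (R) in
theorem sum_tensorCoord (t : U ⊗[k] G) : ∑ i, tensorCoord R U b i t ⊗ₜ[k] b i = t := by
  induction t with
  | zero => simp
  | add s t hs ht =>
    conv_rhs => rw [← hs, ← ht]
    simp only [map_add, TensorProduct.add_tmul, Finset.sum_add_distrib]
  | tmul u x =>
    conv_rhs => rw [← b.sum_repr x, TensorProduct.tmul_sum]
    exact Finset.sum_congr rfl fun i _ => by
      rw [tensorCoord_tmul, TensorProduct.smul_tmul]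
      rfl

theorem tensorCoord_sum (u : κ → U) (i : κ) :
    tensorCoord R U b i (∑ l, u l ⊗ₜ[k] b l) = u i := by
  classical
  simp [tensorCoord_tmul, Finsupp.single_apply]

include b in
-- A finite basis of `G` identifies `U ⊗ G` with a finite power of `U`, compatibly with `R`.
theorem IsAdicComplete.tensor (hU : IsAdicComplete (Ideal.span {h}) U) :
    IsAdicComplete (Ideal.span {h}) (U ⊗[k] G) := by
  let e : (κ → U) ≃ₗ[R] U ⊗[k] G := LinearEquiv.symm
    { LinearMap.pi (tensorCoord R U b) with
      invFun := fun u => ∑ l, u l ⊗ₜ[k] b l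
      left_inv := sum_tensorCoord R b
      right_inv := fun u => funext fun i => tensorCoord_sum b u i }
  exact IsAdicComplete.of_linearEquiv e (IsAdicComplete.pi hU)

include b in
theorem IsEquivMod.tensor {j : U →ₗ[R] V} (hj : IsEquivMod h j) :
    IsEquivMod h (TensorProduct.AlgebraTensorModule.map j (LinearMap.id : G →ₗ[k] G)) where
  surj v := by
    choose u v' huv using fun i => hj.surj (tensorCoord R V b i v)
    refine ⟨∑ l, u l ⊗ₜ[k] b l, ∑ l, v' l ⊗ₜ[k] b l, ?_⟩
    conv_lhs => rw [← sum_tensorCoord R b v]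
    simp only [huv, TensorProduct.add_tmul, Finset.sum_add_distrib, map_sum,
      TensorProduct.AlgebraTensorModule.map_tmul, LinearMap.id_apply, Finset.smul_sum,
      TensorProduct.smul_tmul']
  inj t v htv := by
    choose u hu using fun i => hj.inj (tensorCoord R U b i t) (tensorCoord R V b i v) (by
      rw [← tensorCoord_map, htv, map_smul])
    refine ⟨∑ l, u l ⊗ₜ[k] b l, ?_⟩
    conv_lhs => rw [← sum_tensorCoord R b t]
    simp only [hu, Finset.smul_sum, TensorProduct.smul_tmul']
  torsion_free v hv := by
    rw [← sum_tensorCoord R b v]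
    refine Finset.sum_eq_zero fun i _ => ?_
    rw [hj.torsion_free (tensorCoord R V b i v) (by rw [← map_smul, hv, map_zero]),
      TensorProduct.zero_tmul]

end TensorFinite

/-! ### The enveloping dialgebra -/

section Dialgebra

variable {k g : Type*} [Field k] [CharZero k] [AddCommGroup g] [Module k g] [LodayAlgebra k g]

theorem udBar_tmul (f : Uh k (GLie k g)) (x : g) :
    udBar k g (f ⊗ₜ x) = f * ugen k (GLie k g) (proj k g x) := by
  simp [udBar]

theorem udBar_smul (u : Uh k (GLie k g)) (a : Ud k g) : udBar k g (u • a) = u * udBar k g a := by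
  induction a using TensorProduct.induction_on with
  | zero => simp
  | add a b ha hb => rw [smul_add, map_add, map_add, ha, hb, mul_add]
  | tmul f x => rw [TensorProduct.smul_tmul', udBar_tmul, udBar_tmul, smul_eq_mul, mul_assoc]

theorem udBar_hsmul (r : k⟦X⟧) (a : Ud k g) : udBar k g (r • a) = r • udBar k g a := by
  induction a using TensorProduct.induction_on with
  | zero => simp
  | add a b ha hb => rw [smul_add, map_add, map_add, ha, hb, smul_add]
  | tmul f x => rw [TensorProduct.smul_tmul', udBar_tmul, udBar_tmul, smul_mul_assoc]

/-- The right action of `U_ħ(g_Lie)` on `Ud_ħ(g)`. -/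
def rmul (a : Ud k g) (u : Uh k (GLie k g)) : Ud k g := (rightAct k g u).unop a

theorem rmul_one (a : Ud k g) : rmul a 1 = a := by simp [rmul]

theorem rmul_ugen (a : Ud k g) (y : GLie k g) : rmul a (ugen k _ y) = rightOp k g y a := by
  simp [rmul, rightAct, ulift_ugen]

theorem rmul_add (a : Ud k g) (u v : Uh k (GLie k g)) : rmul a (u + v) = rmul a u + rmul a v := by
  simp [rmul]

theorem rmul_smul (a : Ud k g) (r : k⟦X⟧) (u : Uh k (GLie k g)) :
    rmul a (r • u) = r • rmul a u := by
  simp [rmul]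

theorem rmul_mul (a : Ud k g) (u v : Uh k (GLie k g)) : rmul a (u * v) = rmul (rmul a u) v := by
  simp [rmul]

theorem add_rmul (a b : Ud k g) (u : Uh k (GLie k g)) : rmul (a + b) u = rmul a u + rmul b u := by
  simp [rmul]

theorem smul_rmul (r : k⟦X⟧) (a : Ud k g) (u : Uh k (GLie k g)) :
    rmul (r • a) u = r • rmul a u := by
  simp [rmul]

theorem rightOp_smul (y : GLie k g) (u : Uh k (GLie k g)) (a : Ud k g) :
    rightOp k g y (u • a) = u • rightOp k g y a := by
  induction a using TensorProduct.induction_on with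
  | zero => simp
  | add a b ha hb => rw [smul_add, map_add, map_add, ha, hb, smul_add]
  | tmul f x =>
    rw [TensorProduct.smul_tmul', rightOp_tmul, rightOp_tmul, smul_sub, TensorProduct.smul_tmul',
      TensorProduct.smul_tmul', TensorProduct.smul_tmul', TensorProduct.smul_tmul']
    simp only [smul_eq_mul, mul_assoc, mul_smul_comm]

/-- This is the purpose of the correction term in the right action: `f ȳ x̄ - ħ f [ȳ,x̄] = f x̄ ȳ`,
so `udBar` is right linear. -/
theorem udBar_rightOp (y : GLie k g) (a : Ud k g) :
    udBar k g (rightOp k g y a) = udBar k g a * ugen k _ y := by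
  induction a using TensorProduct.induction_on with
  | zero => simp
  | add a b ha hb => rw [map_add, map_add, map_add, ha, hb, add_mul]
  | tmul f x =>
    obtain ⟨y, rfl⟩ := Submodule.Quotient.mk_surjective _ y
    have h := ugen_comm k (GLie k g) (Submodule.Quotient.mk y) (Submodule.Quotient.mk x)
    rw [rightOp_tmul, map_sub, udBar_hsmul, udBar_tmul, udBar_tmul, udBar_tmul, ad_proj, mul_assoc,
      mul_assoc, sub_eq_iff_eq_add, ← mul_smul_comm, ← mul_add]
    congr 1
    rw [← sub_eq_iff_eq_add']
    exact h

/-- The bimodule law. Together with the left and right linearity of `udBar` it implies the dialgebra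
axioms formally. -/
theorem smul_rmul_comm (u v : Uh k (GLie k g)) (a : Ud k g) :
    rmul (u • a) v = u • rmul a v := by
  induction v using uh_induction generalizing a with
  | one => rw [rmul_one, rmul_one]
  | gen y => rw [rmul_ugen, rmul_ugen, rightOp_smul]
  | add v w hv hw => rw [rmul_add, rmul_add, hv, hw, smul_add]
  | smul r v hv => rw [rmul_smul, rmul_smul, hv, smul_comm]
  | mul v w hv hw => rw [rmul_mul, rmul_mul, hv, hw]

theorem udBar_rmul (a : Ud k g) (v : Uh k (GLie k g)) : udBar k g (rmul a v) = udBar k g a * v := by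
  induction v using uh_induction generalizing a with
  | one => rw [rmul_one, mul_one]
  | gen y => rw [rmul_ugen, udBar_rightOp]
  | add v w hv hw => rw [rmul_add, map_add, hv, hw, mul_add]
  | smul r v hv => rw [rmul_smul, udBar_hsmul, hv, mul_smul_comm]
  | mul v w hv hw => rw [rmul_mul, hw, hv, mul_assoc]

theorem udVd_eq (a b : Ud k g) : udVd k g a b = udBar k g a • b := rfl

theorem udDv_eq (a b : Ud k g) : udDv k g a b = rmul a (udBar k g b) := rfl

/-- `Ud_ħ(g)` is an associative dialgebra. -/
theorem isAssociativeDialgebra_ud : IsAssociativeDialgebra (udVd k g) (udDv k g) where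
  vd_assoc a b c := by simp only [udVd_eq, udBar_smul, mul_smul]
  dv_assoc a b c := by simp only [udDv_eq, udBar_rmul, rmul_mul]
  vd_vd a b c := by simp only [udVd_eq, udDv_eq, udBar_smul, udBar_rmul]
  vd_dv a b c := by simp only [udVd_eq, udDv_eq, smul_rmul_comm]
  dv_dv a b c := by simp only [udVd_eq, udDv_eq, udBar_smul, udBar_rmul]

variable (k g) in
/-- The product `⊢` of `Ud_ħ(g)` as a bilinear map. -/
def udVdLin : Ud k g →ₗ[k⟦X⟧] Ud k g →ₗ[k⟦X⟧] Ud k g :=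
  LinearMap.mk₂ _ (udVd k g)
    (fun a b c => by simp only [udVd_eq, map_add, add_smul])
    (fun r a b => by simp only [udVd_eq, udBar_hsmul, smul_assoc])
    (fun a b c => by simp only [udVd_eq, smul_add])
    (fun r a b => by simp only [udVd_eq, smul_comm r])

variable (k g) in
/-- The product `⊣` of `Ud_ħ(g)` as a bilinear map. -/
def udDvLin : Ud k g →ₗ[k⟦X⟧] Ud k g →ₗ[k⟦X⟧] Ud k g :=
  LinearMap.mk₂ _ (udDv k g)
    (fun a b c => by simp only [udDv_eq, add_rmul])
    (fun r a b => by simp only [udDv_eq, smul_rmul])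
    (fun a b c => by simp only [udDv_eq, map_add, rmul_add])
    (fun r a b => by simp only [udDv_eq, udBar_hsmul, rmul_smul])

end Dialgebra

/-! ### The classical limit -/

section Limit

variable {k g : Type*} [Field k] [AddCommGroup g] [Module k g] [LodayAlgebra k g] [CharZero k]

/-- Both summands of `act` are derivations in the acting function. This matches the Leibniz rule of
commutators in `exists_smul_sub_rmul`. -/
theorem act_mul (f h : Sym k (GLie k g)) (a : Poly k g) :
    act k g (f * h) a = f • act k g h a + h • act k g f a := by
  induction a using TensorProduct.induction_on with
  | zero => simp
  | add a b ha hb => rw [map_add, map_add, map_add, ha, hb, smul_add, smul_add]; abel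
  | tmul l x =>
    simp only [act, LinearMap.add_apply, LinearMap.rTensor_tmul, LinearMap.restrictScalars_apply,
      LinearMap.liftBaseChange_tmul, LinearMap.flip_apply, actLin_mul, poisson_mul_left,
      smul_add, TensorProduct.add_tmul, TensorProduct.smul_tmul', smul_eq_mul]
    rw [smul_comm l f, smul_comm l h]
    abel

theorem act_add (f h : Sym k (GLie k g)) (a : Poly k g) :
    act k g (f + h) a = act k g f a + act k g h a := by
  induction a using TensorProduct.induction_on with
  | zero => simp
  | add a b ha hb => rw [map_add, map_add, map_add, ha, hb]; abel
  | tmul l x =>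
    simp only [act, LinearMap.add_apply, LinearMap.rTensor_tmul, LinearMap.restrictScalars_apply,
      LinearMap.liftBaseChange_tmul, LinearMap.flip_apply, map_add, TensorProduct.add_tmul]
    abel

theorem act_smul (c : k) (f : Sym k (GLie k g)) (a : Poly k g) :
    act k g (c • f) a = c • act k g f a := by
  induction a using TensorProduct.induction_on with
  | zero => simp
  | add a b ha hb => rw [map_add, map_add, ha, hb, smul_add]
  | tmul l x =>
    simp only [act, LinearMap.add_apply, LinearMap.rTensor_tmul, LinearMap.restrictScalars_apply,
      LinearMap.liftBaseChange_tmul, LinearMap.flip_apply, map_smul, Derivation.map_smul, smul_add,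
      LinearMap.smul_apply, TensorProduct.smul_tmul']
    rw [smul_comm l c]

theorem act_one (a : Poly k g) : act k g 1 a = 0 := by
  have h := act_mul (1 : Sym k (GLie k g)) 1 a
  rw [mul_one, one_smul] at h
  exact left_eq_add.1 h

theorem act_gen_tmul (y : GLie k g) (f : Sym k (GLie k g)) (x : g) :
    act k g (gen k _ y) (f ⊗ₜ x) =
      poisson k _ (gen k _ y) f ⊗ₜ x + f ⊗ₜ ad k g y x := by
  obtain ⟨y, rfl⟩ := Submodule.Quotient.mk_surjective _ y
  simp only [act, LinearMap.add_apply, LinearMap.rTensor_tmul, LinearMap.restrictScalars_apply,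
    LinearMap.liftBaseChange_tmul, LinearMap.flip_apply, ad_proj]
  congr 1
  refine (congrArg (f • ·) (actLin_gen k g y x)).trans ?_
  simp [TensorProduct.smul_tmul']

theorem limZero_tmul (f : SymH k (GLie k g)) (x : g) :
    limZero k g (f ⊗ₜ x) = PowerSeries.coeff 0 f ⊗ₜ x := rfl

theorem limZero_hsmul (r : k⟦X⟧) (a : PolyStar k g) :
    limZero k g (r • a) = PowerSeries.coeff 0 r • limZero k g a := by
  induction a using TensorProduct.induction_on with
  | zero => simp
  | add a b ha hb => rw [smul_add, map_add, map_add, ha, hb, smul_add]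
  | tmul f x =>
    rw [TensorProduct.smul_tmul', limZero_tmul, limZero_tmul, coeff_zero_smul,
      TensorProduct.smul_tmul']

theorem limZero_hbar_smul (a : PolyStar k g) : limZero k g (hbar k • a) = 0 := by
  rw [limZero_hsmul, PowerSeries.coeff_zero_X, zero_smul]

variable (P : StarProduct k (GLie k g))

/-- The classical limit `U_ħ(g_Lie) → S(g_Lie)`. -/
def symLim (u : Uh k (GLie k g)) : Sym k (GLie k g) := PowerSeries.coeff 0 (starLin P u)

theorem symLim_hsmul (r : k⟦X⟧) (u : Uh k (GLie k g)) :
    symLim P (r • u) = PowerSeries.coeff 0 r • symLim P u := by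
  rw [symLim, map_smul, coeff_zero_smul, symLim]

theorem symLim_add (u v : Uh k (GLie k g)) : symLim P (u + v) = symLim P u + symLim P v := by
  rw [symLim, map_add, map_add, symLim, symLim]

theorem symLim_mul (u v : Uh k (GLie k g)) : symLim P (u * v) = symLim P u * symLim P v :=
  (isQuantization_starLin P).coeff_mul u v

theorem symLim_one : symLim P 1 = 1 := (isQuantization_starLin P).coeff_one

theorem symLim_ugen (x : GLie k g) : symLim P (ugen k _ x) = gen k _ x :=
  (isQuantization_starLin P).coeff_gen x

/-- The classical limit `Ud_ħ(g) → Poly(g^*)`. -/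
def polyLim : Ud k g →+ Poly k g :=
  (limZero k g).toAddMonoidHom.comp (starMap P).toAddMonoidHom

theorem limZero_starMap (a : Ud k g) : limZero k g (starMap P a) = polyLim P a := rfl

theorem polyLim_tmul (f : Uh k (GLie k g)) (x : g) : polyLim P (f ⊗ₜ x) = symLim P f ⊗ₜ x := rfl

theorem polyLim_hsmul (r : k⟦X⟧) (a : Ud k g) :
    polyLim P (r • a) = PowerSeries.coeff 0 r • polyLim P a := by
  rw [← limZero_starMap, map_smul, limZero_hsmul, limZero_starMap]

theorem polyLim_hbar_smul (a : Ud k g) : polyLim P (hbar k • a) = 0 := by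
  rw [polyLim_hsmul, PowerSeries.coeff_zero_X, zero_smul]

theorem polyLim_smul (u : Uh k (GLie k g)) (a : Ud k g) :
    polyLim P (u • a) = symLim P u • polyLim P a := by
  induction a using TensorProduct.induction_on with
  | zero => simp
  | add a b ha hb => rw [smul_add, map_add, map_add, ha, hb, smul_add]
  | tmul f x =>
    rw [TensorProduct.smul_tmul', polyLim_tmul, polyLim_tmul, TensorProduct.smul_tmul',
      smul_eq_mul, symLim_mul, smul_eq_mul]

theorem polyLim_rightOp (y : GLie k g) (a : Ud k g) :
    polyLim P (rightOp k g y a) = gen k _ y • polyLim P a := by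
  induction a using TensorProduct.induction_on with
  | zero => simp
  | add a b ha hb => rw [map_add, map_add, map_add, ha, hb, smul_add]
  | tmul f x =>
    rw [rightOp_tmul, map_sub, polyLim_hbar_smul, sub_zero, polyLim_tmul, polyLim_tmul,
      symLim_mul, symLim_ugen, TensorProduct.smul_tmul', smul_eq_mul, mul_comm]

/-- The correction in the right action carries a factor `ħ`, so left and right actions have the same
limit. -/
theorem polyLim_rmul (a : Ud k g) (u : Uh k (GLie k g)) :
    polyLim P (rmul a u) = symLim P u • polyLim P a := by
  induction u using uh_induction generalizing a with
  | one => rw [rmul_one, symLim_one, one_smul]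
  | gen y => rw [rmul_ugen, polyLim_rightOp, symLim_ugen]
  | add v w hv hw => rw [rmul_add, map_add, hv, hw, symLim_add, add_smul]
  | smul r v hv => rw [rmul_smul, polyLim_hsmul, hv, symLim_hsmul, smul_assoc]
  | mul v w hv hw => rw [rmul_mul, hw, hv, symLim_mul, smul_smul, mul_comm]

theorem polyBar_polyLim (a : Ud k g) : polyBar k g (polyLim P a) = symLim P (udBar k g a) := by
  induction a using TensorProduct.induction_on with
  | zero => simp [symLim]
  | add a b ha hb => rw [map_add, map_add, map_add, ha, hb, symLim_add]
  | tmul f x =>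
    rw [polyLim_tmul, udBar_tmul, symLim_mul, symLim_ugen]
    simp [polyBar]

theorem exists_ugen_comm (y : GLie k g) (f : Uh k (GLie k g)) :
    ∃ d, ugen k _ y * f - f * ugen k _ y = hbar k • d ∧
      symLim P d = poisson k _ (gen k _ y) (symLim P f) := by
  obtain ⟨d, hd⟩ := modHbar_commute (ugen k (GLie k g) y) f
  refine ⟨d, hd, ?_⟩
  obtain ⟨F, hF⟩ := eq_const_add (starLin P f)
  have h1 := congrArg (fun u => PowerSeries.coeff 1 (starLin P u)) hd
  simp only [map_smul, coeff_succ_hbar_smul, map_sub, starLin_mul, starLin_ugen] at h1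
  rw [symLim, ← h1, ← P.semiclassical_limit]
  -- The part `ħ F` of `I f` contributes at order one only a commutator of constant terms, which
  -- vanishes.
  conv_lhs => rw [hF]
  simp only [map_add, map_smul, LinearMap.add_apply, LinearMap.smul_apply, coeff_succ_hbar_smul,
    map_sub, P.coeff_zero_mul]
  rw [mul_comm (PowerSeries.coeff 0 F), add_sub_add_right_eq_sub]
  rfl

/-- Commutators in `Ud_ħ(g)` are divisible by `ħ`, with the expected classical limit. -/
theorem exists_smul_sub_rmul (u : Uh k (GLie k g)) (b : Ud k g) :
    ∃ c, u • b - rmul b u = hbar k • c ∧ polyLim P c = act k g (symLim P u) (polyLim P b) := by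
  induction u using uh_induction generalizing b with
  | one => exact ⟨0, by simp [rmul_one], by rw [symLim_one, act_one, map_zero]⟩
  | gen y =>
    induction b using TensorProduct.induction_on with
    | zero => exact ⟨0, by simp [rmul_ugen], by simp⟩
    | add a b ha hb =>
      obtain ⟨c, hc, hc'⟩ := ha
      obtain ⟨d, hd, hd'⟩ := hb
      exact ⟨c + d, by rw [smul_add, add_rmul, smul_add, ← hc, ← hd, add_sub_add_comm],
        by rw [map_add, map_add, map_add, hc', hd']⟩
    | tmul f x =>
      obtain ⟨d, hd, hd'⟩ := exists_ugen_comm P y f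
      -- The first summand comes from commuting `y` with `f` in `U_ħ`, the second from the
      -- correction term of the right action.
      refine ⟨d ⊗ₜ x + f ⊗ₜ ad k g y x, ?_, ?_⟩
      · rw [rmul_ugen, rightOp_tmul, TensorProduct.smul_tmul', smul_eq_mul, smul_add,
          TensorProduct.smul_tmul' (hbar k) d x, ← hd, TensorProduct.sub_tmul]
        abel
      · rw [map_add, polyLim_tmul, polyLim_tmul, polyLim_tmul, hd', symLim_ugen, act_gen_tmul]
  | add v w hv hw =>
    obtain ⟨c, hc, hc'⟩ := hv b
    obtain ⟨d, hd, hd'⟩ := hw b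
    exact ⟨c + d, by rw [add_smul, rmul_add, smul_add, ← hc, ← hd, add_sub_add_comm],
      by rw [map_add, symLim_add, act_add, hc', hd']⟩
  | smul r v hv =>
    obtain ⟨c, hc, hc'⟩ := hv b
    exact ⟨r • c, by rw [smul_assoc, rmul_smul, ← smul_sub, hc, smul_comm],
      by rw [polyLim_hsmul, hc', symLim_hsmul, act_smul]⟩
  | mul v w hv hw =>
    obtain ⟨c, hc, hc'⟩ := hv b
    obtain ⟨d, hd, hd'⟩ := hw b
    -- Leibniz rule: `vw · b - b · vw = v · (w · b - b · w) + (v · b - b · v) · w`.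
    refine ⟨v • d + rmul c w, ?_, ?_⟩
    · rw [smul_add, ← smul_comm v, ← hd, ← smul_rmul, ← hc, rmul_mul, mul_smul, smul_sub,
        sub_eq_add_neg (v • b), add_rmul, ← smul_rmul_comm, ← neg_one_smul (k⟦X⟧) (rmul b v),
        smul_rmul, neg_one_smul]
      abel
    · rw [map_add, polyLim_smul, polyLim_rmul, hc', hd', symLim_mul, act_mul]

theorem isEquivMod_starMap [FiniteDimensional k g] : IsEquivMod (hbar k) (starMap P) :=
  IsEquivMod.tensor (Module.finBasis k g) (isQuantization_starLin P).isEquivMod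

theorem isAdicComplete_polyStar [FiniteDimensional k g] :
    IsAdicComplete (Ideal.span {hbar k}) (PolyStar k g) :=
  IsAdicComplete.tensor (Module.finBasis k g) isAdicComplete_symH

variable [FiniteDimensional k g]

/-- The product `⊢` of `Poly_⋆(g^*)`. -/
def starVd : PolyStar k g →ₗ[k⟦X⟧] PolyStar k g →ₗ[k⟦X⟧] PolyStar k g :=
  (isEquivMod_starMap P).extend₂ isAdicComplete_polyStar ((udVdLin k g).compr₂ (starMap P))

/-- The product `⊣` of `Poly_⋆(g^*)`. -/
def starDv : PolyStar k g →ₗ[k⟦X⟧] PolyStar k g →ₗ[k⟦X⟧] PolyStar k g :=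
  (isEquivMod_starMap P).extend₂ isAdicComplete_polyStar ((udDvLin k g).compr₂ (starMap P))

theorem starVd_starMap (a b : Ud k g) :
    starVd P (starMap P a) (starMap P b) = starMap P (udVd k g a b) :=
  (isEquivMod_starMap P).extend₂_apply isAdicComplete_polyStar _ a b

theorem starDv_starMap (a b : Ud k g) :
    starDv P (starMap P a) (starMap P b) = starMap P (udDv k g a b) :=
  (isEquivMod_starMap P).extend₂_apply isAdicComplete_polyStar _ a b

theorem isTransport_star : IsTransport P (starVd P) (starDv P) :=
  ⟨fun a b => (starVd_starMap P a b).symm, fun a b => (starDv_starMap P a b).symm⟩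

theorem IsTransport.unique {vd dv : PolyStar k g →ₗ[k⟦X⟧] PolyStar k g →ₗ[k⟦X⟧] PolyStar k g}
    (H : IsTransport P vd dv) : vd = starVd P ∧ dv = starDv P :=
  ⟨(isEquivMod_starMap P).hom_ext₂ isAdicComplete_polyStar fun a b => by
      rw [← H.1, starVd_starMap],
    (isEquivMod_starMap P).hom_ext₂ isAdicComplete_polyStar fun a b => by
      rw [← H.2, starDv_starMap]⟩

theorem isAssociativeDialgebra_star :
    IsAssociativeDialgebra (fun a b => starVd P a b) (fun a b => starDv P a b) := by
  have hU := isAssociativeDialgebra_ud (k := k) (g := g)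
  -- Three axioms rebracket `(ab)c` as `a(bc)` and share this form; the other two keep the
  -- bracketing and are extended separately.
  have inner : ∀ (α β γ δ : PolyStar k g →ₗ[k⟦X⟧] PolyStar k g →ₗ[k⟦X⟧] PolyStar k g),
      (∀ a b c, γ (α (starMap P a) (starMap P b)) (starMap P c) =
        δ (starMap P a) (β (starMap P b) (starMap P c))) →
      ∀ a b c, γ (α a b) c = δ a (β b c) := by
    intro α β γ δ H a b c
    exact LinearMap.congr_fun (LinearMap.congr_fun (LinearMap.congr_fun
      ((isEquivMod_starMap P).hom_ext₃ isAdicComplete_polyStar (φ := α.compr₂ γ)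
        (ψ := (LinearMap.llcomp _ _ _ _ ∘ₗ δ).compl₂ β) H) a) b) c
  refine ⟨inner _ _ _ _ ?_, inner _ _ _ _ ?_, fun a b c => ?_, inner _ _ _ _ ?_,
    fun a b c => ?_⟩
  · intro a b c
    simp only [starVd_starMap, hU.vd_assoc]
  · intro a b c
    simp only [starDv_starMap, hU.dv_assoc]
  · refine LinearMap.congr_fun (LinearMap.congr_fun (LinearMap.congr_fun
      ((isEquivMod_starMap P).hom_ext₃ isAdicComplete_polyStar
        (φ := (starVd P).compr₂ (starVd P)) (ψ := (starDv P).compr₂ (starVd P)) ?_) a) b) c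
    intro a b c
    simp only [LinearMap.compr₂_apply, starVd_starMap, starDv_starMap, hU.vd_vd]
  · intro a b c
    simp only [starVd_starMap, starDv_starMap, hU.vd_dv]
  · refine LinearMap.congr_fun (LinearMap.congr_fun (LinearMap.congr_fun
      ((isEquivMod_starMap P).hom_ext₃ isAdicComplete_polyStar
        (φ := (LinearMap.llcomp _ _ _ _ ∘ₗ starDv P).compl₂ (starDv P))
        (ψ := (LinearMap.llcomp _ _ _ _ ∘ₗ starDv P).compl₂ (starVd P)) ?_) a) b) c
    intro a b c
    simp only [LinearMap.compl₂_apply, LinearMap.comp_apply, LinearMap.llcomp_apply,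
      starVd_starMap, starDv_starMap, hU.dv_dv]

theorem limZero_starVd (a b : PolyStar k g) :
    limZero k g (starVd P a b) = perm k g (limZero k g a) (limZero k g b) := by
  obtain ⟨a, a', rfl⟩ := (isEquivMod_starMap P).surj a
  obtain ⟨b, b', rfl⟩ := (isEquivMod_starMap P).surj b
  simp only [map_add, map_smul, LinearMap.add_apply, LinearMap.smul_apply, limZero_hbar_smul,
    add_zero, starVd_starMap, limZero_starMap]
  rw [udVd_eq, polyLim_smul, perm, polyBar_polyLim]

/-- Every dialgebra commutator therefore tends to `0`, which disposes of the remainder terms in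
`exists_commutator_eq_hbar_smul`. -/
theorem limZero_starDv (a b : PolyStar k g) :
    limZero k g (starDv P b a) = limZero k g (starVd P a b) := by
  rw [limZero_starVd]
  obtain ⟨a, a', rfl⟩ := (isEquivMod_starMap P).surj a
  obtain ⟨b, b', rfl⟩ := (isEquivMod_starMap P).surj b
  simp only [map_add, map_smul, LinearMap.add_apply, LinearMap.smul_apply, limZero_hbar_smul,
    add_zero, starDv_starMap, limZero_starMap]
  rw [udDv_eq, polyLim_rmul, perm, polyBar_polyLim]

/-- Dialgebra commutators in `Poly_⋆(g^*)` are divisible by `ħ`, and the quotient tends to the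
Loday-Poisson bracket. -/
theorem exists_commutator_eq_hbar_smul (a b : PolyStar k g) :
    ∃ c, hbar k • c = starVd P a b - starDv P b a ∧
      limZero k g c = lodayPoisson k g (limZero k g a) (limZero k g b) := by
  obtain ⟨a, a', rfl⟩ := (isEquivMod_starMap P).surj a
  obtain ⟨b, b', rfl⟩ := (isEquivMod_starMap P).surj b
  obtain ⟨c, hc, hc'⟩ := exists_smul_sub_rmul P (udBar k g a) b
  -- Both arguments are images under `I ⊗ 1` plus `ħ` times a remainder. The quotient is that of the
  -- images plus undivided commutators involving a remainder, and the latter have limit `0`.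
  refine ⟨starMap P c + (starVd P (starMap P a) b' - starDv P b' (starMap P a)) +
    (starVd P a' (starMap P b + hbar k • b') - starDv P (starMap P b + hbar k • b') a'), ?_, ?_⟩
  · rw [smul_add, smul_add, ← map_smul, ← hc, map_sub, ← udVd_eq, ← udDv_eq, ← starVd_starMap,
      ← starDv_starMap]
    simp only [map_add, map_smul, LinearMap.add_apply, LinearMap.smul_apply, smul_sub, smul_add]
    abel
  · rw [map_add, map_add, map_sub, map_sub, limZero_starDv, limZero_starDv, sub_self, sub_self,
      add_zero, add_zero]
    simp only [map_add, limZero_hbar_smul, add_zero, limZero_starMap, hc']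
    rw [lodayPoisson, polyBar_polyLim]

end Limit

end LodayQuantization

end

open LodayQuantization in
theorem mainTheorem4 {k : Type*} [Field k] [CharZero k] {g : Type*} [AddCommGroup g] [Module k g]
    [LodayAlgebra k g] [FiniteDimensional k g] :
    -- star products on `S(g_Lie)[[ħ]]` exist, even with `x ⋆ y = x y + (ħ/2) [x,y]` on generators
    (∃ P : StarProduct k (GLie k g), ∀ x y : GLie k g,
      P.mul (const k (GLie k g) (gen k (GLie k g) x)) (const k (GLie k g) (gen k (GLie k g) y)) =
        const k (GLie k g) (gen k (GLie k g) x * gen k (GLie k g) y) +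
          hbar k • const k (GLie k g) ((2 : k)⁻¹ • gen k (GLie k g) ⁅x, y⁆)) ∧
    ∀ P : StarProduct k (GLie k g),
      -- `I ⊗ 1` is an isomorphism of (`ħ`-adically completed) `k[[ħ]]`-modules
      (IsAdicComplete (Ideal.span {hbar k}) (PolyStar k g) ∧
        Function.Bijective (AdicCompletion.map (Ideal.span {hbar k}) (starMap P))) ∧
      -- the dialgebra structure transported along `I ⊗ 1` exists and is unique
      ∃ vd dv : PolyStar k g →ₗ[k⟦X⟧] PolyStar k g →ₗ[k⟦X⟧] PolyStar k g,
        IsTransport P vd dv ∧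
        (∀ vd' dv' : PolyStar k g →ₗ[k⟦X⟧] PolyStar k g →ₗ[k⟦X⟧] PolyStar k g,
          IsTransport P vd' dv' → vd' = vd ∧ dv' = dv) ∧
        IsAssociativeDialgebra (fun a b => vd a b) (fun a b => dv a b) ∧
        -- `a ⊢ b` tends to the perm product
        (∀ a b : PolyStar k g, limZero k g (vd a b) = perm k g (limZero k g a) (limZero k g b)) ∧
        -- the commutator `a ⊢ b - b ⊣ a` is uniquely divisible by `ħ`, and the quotient tends
        -- to the Loday-Poisson bracket
        (∀ a b : PolyStar k g, ∃ c : PolyStar k g,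
          hbar k • c = vd a b - dv b a ∧
          (∀ c' : PolyStar k g, hbar k • c' = vd a b - dv b a → c' = c) ∧
          limZero k g c = lodayPoisson k g (limZero k g a) (limZero k g b)) := by
  refine ⟨⟨guttStar (Module.finBasis k (GLie k g)), guttStar_gen _⟩, fun P => ?_⟩
  have hP := isEquivMod_starMap P
  refine ⟨⟨isAdicComplete_polyStar, hP.adicCompletion_map_bijective⟩, starVd P, starDv P,
    isTransport_star P, fun vd dv H => H.unique, isAssociativeDialgebra_star P, limZero_starVd P,
    fun a b => ?_⟩
  obtain ⟨c, hc, hlim⟩ := exists_commutator_eq_hbar_smul P a b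
  refine ⟨c, hc, fun c' hc' => ?_, hlim⟩
  rw [← sub_eq_zero]
  exact hP.torsion_free _ (by rw [smul_sub, hc, hc', sub_self])
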